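/- For a partition $\lambda=(\lambda_1\ge\lambda_2\ge\cdots)$ of $d$ put $p_3(\lambda)=\sum_{i\ge 1}\big[(\lambda_i-i+\tfrac12)^3-(-i+\tfrac12)^3\big]$, and let $\chi^\lambda_\mu$ be the irreducible character of the symmetric group $S_d$ attached to $\lambda$, evaluated at permutations of cycle type $\mu$. For integers $g\ge 0$, $d\ge 1$ and a partition $\beta=(\beta_1,\dots,\beta_n)$ of $d$ with an odd number $n$ of parts, let $s=g+\frac{n-1}{2}$ and define the one-part double Hurwitz number with completed $3$-cycles by $$H^{g,(2)}_{(d),\beta}=\frac{1}{d\,\prod_{j}\beta_j}\sum_{\lambda\vdash d}\chi^\lambda_{(d)}\left(\frac{p_3(\lambda)}{3!}\right)^{s}\chi^\lambda_\beta .$$ **Corollary 4.1 (strong polynomiality).** Fix $g\ge 0$ and an odd $n\ge 1$ with $(g,n)\neq(0,1)$. Then there is a polynomial $P\in\mathbb{Q}[x_1,\dots,x_n]$, depending only on $g$ and $n$, such that $H^{g,(2)}_{(d),\beta}=P(\beta_1,\dots,\beta_n)$ for every $d$ and every partition $\beta$ of $d$ with exactly $n$ parts, the parts $\beta_1,\dots,\beta_n$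 being listed in any order. The largest and the smallest degree of a nonzero homogeneous component of $P$ are $3g+\frac{n-3}{2}$ and $g+\frac{n-3}{2}$ respectively. -/

import Mathlib

noncomputable section

namespace Hurwitz

open Equiv

/-- The Young diagram (English convention: cells `(row, column)`, both indexed from `0`) whose row
lengths are the parts of `p` in weakly decreasing order. -/
def diagram {d : ℕ} (p : d.Partition) : YoungDiagram :=
  YoungDiagram.ofRowLens (p.parts.sort (· ≥ ·)) (p.parts.pairwise_sort (· ≥ ·)).sortedGE

/-- The symmetric group on the cells of a Young diagram with `d` cells; a copy of `S_d` in which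
the tableau filling is the tautological one. -/
abbrev CellPerm (Y : YoungDiagram) : Type := Perm Y.cells

open Classical in
/-- The row symmetrizer: the sum of all permutations preserving every row. -/
def rowSymmetrizer (Y : YoungDiagram) : MonoidAlgebra ℚ (CellPerm Y) :=
  ∑ σ : CellPerm Y with ∀ c, (σ c).1.1 = c.1.1, MonoidAlgebra.of ℚ (CellPerm Y) σ

open Classical in
/-- The column antisymmetrizer: the signed sum of all permutations preserving every column. -/
def colAntisymmetrizer (Y : YoungDiagram) : MonoidAlgebra ℚ (CellPerm Y) :=
  ∑ σ : CellPerm Y with ∀ c, (σ c).1.2 = c.1.2,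
    ((Perm.sign σ : ℤ) : ℚ) • MonoidAlgebra.of ℚ (CellPerm Y) σ

/-- The Young symmetrizer. -/
def youngSymmetrizer (Y : YoungDiagram) : MonoidAlgebra ℚ (CellPerm Y) :=
  rowSymmetrizer Y * colAntisymmetrizer Y

/-- The Specht module: the left ideal of the group algebra generated by the Young symmetrizer. -/
abbrev SpechtModule (Y : YoungDiagram) : Ideal (MonoidAlgebra ℚ (CellPerm Y)) :=
  Ideal.span {youngSymmetrizer Y}

/-- The irreducible representation of the symmetric group attached to a Young diagram: left
multiplication on the Specht module. -/
def spechtRep (Y : YoungDiagram) : Representation ℚ (CellPerm Y) (SpechtModule Y) :=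
  (Algebra.lsmul ℚ ℚ (SpechtModule Y)).toMonoidHom.comp (MonoidAlgebra.of ℚ (CellPerm Y))

theorem card_cellsOfRowLens (w : List ℕ) : (YoungDiagram.cellsOfRowLens w).card = w.sum := by
  induction w with
  | nil => simp [YoungDiagram.cellsOfRowLens]
  | cons a w ih =>
    rw [YoungDiagram.cellsOfRowLens, Finset.card_union_of_disjoint]
    · simp [ih]
    · rw [Finset.disjoint_left]
      rintro ⟨i, j⟩ h1 h2
      simp at h1 h2
      omega

theorem card_cells_diagram {d : ℕ} (p : d.Partition) : Fintype.card (diagram p).cells = d := by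
  have h : (p.parts.sort (· ≥ ·)).sum = d := by
    rw [← Multiset.sum_coe, Multiset.sort_eq, p.parts_sum]
  simpa [diagram, YoungDiagram.ofRowLens, h] using card_cellsOfRowLens (p.parts.sort (· ≥ ·))

/-- Every partition of `d` is the cycle type (fixed points included) of a permutation of `d`
objects. -/
theorem exists_perm_parts {d : ℕ} (p q : d.Partition) :
    ∃ σ : CellPerm (diagram p), σ.partition.parts = q.parts := by
  have hsplit : q.parts.filter (2 ≤ ·) + q.parts.filter (¬ 2 ≤ ·) = q.parts :=
    Multiset.filter_add_not _ _
  have hone : q.parts.filter (¬ 2 ≤ ·)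
      = Multiset.replicate (Multiset.card (q.parts.filter (¬ 2 ≤ ·))) 1 := by
    refine Multiset.eq_replicate_card.2 fun x hx => ?_
    have h1 := Multiset.mem_filter.1 hx
    have h2 := q.parts_pos h1.1
    omega
  have hsum : (q.parts.filter (2 ≤ ·)).sum + Multiset.card (q.parts.filter (¬ 2 ≤ ·)) = d := by
    have h := congrArg Multiset.sum hsplit
    rw [Multiset.sum_add, q.parts_sum, hone, Multiset.sum_replicate] at h
    simpa using h
  obtain ⟨σ, hσ⟩ := (Perm.exists_with_cycleType_iff (diagram p).cells
    (m := q.parts.filter (2 ≤ ·))).2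
    ⟨by rw [card_cells_diagram]; omega, fun a ha => (Multiset.mem_filter.1 ha).2⟩
  refine ⟨σ, ?_⟩
  rw [Perm.parts_partition, ← Perm.sum_cycleType, hσ, card_cells_diagram]
  conv_rhs => rw [← hsplit, hone]
  congr 2
  omega

/-- `chi p q` is `χ^p_q`: the irreducible character attached to `p`, evaluated at a permutation
of cycle type `q`. -/
def chi {d : ℕ} (p q : d.Partition) : ℚ :=
  (spechtRep (diagram p)).character (exists_perm_parts p q).choose

/-- The shifted symmetric power sum `p_k` at a partition. Row `i` (counted from `0`) is the part
with index `i + 1`; the terms beyond the last part vanish, so the sum is finite. -/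
def shiftedPowerSum (k : ℕ) {d : ℕ} (p : d.Partition) : ℚ :=
  ∑ᶠ i : ℕ, ((((diagram p).rowLen i : ℚ) - ((i : ℚ) + 1) + 1 / 2) ^ k
    - (-((i : ℚ) + 1) + 1 / 2) ^ k)

/-- The disconnected double Hurwitz number `H^{g,(r)}_{α,β}` with completed `(r+1)`-cycles. The
number `s` of completed cycles is determined by `r s = 2 g - 2 + ℓ(α) + ℓ(β)`, as the
hypothesis `hs` records. -/
def doubleHurwitz {d : ℕ} (g r s : ℕ) (α β : d.Partition)
    (_hs : r * s + 2 = 2 * g + Multiset.card α.parts + Multiset.card β.parts) : ℚ :=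
  1 / ((α.parts.prod : ℚ) * (β.parts.prod : ℚ)) *
    ∑ p : d.Partition,
      chi p α * (shiftedPowerSum (r + 1) p / ((r + 1).factorial : ℚ)) ^ s * chi p β

/-- The set of degrees of the nonzero homogeneous components of a polynomial. -/
def homogeneousDegrees {n : ℕ} (P : MvPolynomial (Fin n) ℚ) : Set ℕ :=
  {k | MvPolynomial.homogeneousComponent k P ≠ 0}

end Hurwitz

end

/-!
A Young symmetrizer `c` satisfies `c ^ 2 = (∏ hook lengths) • c`, so the character of the left ideal
it generates is read off the class averages of `c`. For hooks these averages obey the recursion that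
comes from inducing `1 ⊗ sgn` from `S_(d-k) × S_k`, which yields the sum of two neighbouring hook
characters. Hence the hook characters at cycle type `β` have, up to sign, the generating polynomial
`∏ (1 - X ^ β_i) / (1 - X)`. At `X = 1` it vanishes unless the cycle type is `(d)`; since a non-hook
character is orthogonal to all hook characters, it therefore vanishes at `(d)`.

So `H` is a sum over hooks, and there `p_3` is `d` times a quadratic function of the height. After
centring, the exponential generating function of the moments of the hook polynomial is, up to a
constant, `∏ sinh (β_i t / 2) / sinh (t / 2)`, whose coefficients are polynomials in the `β_i`. The
top degree part is positive at `(1, …, 1)`. The bottom degree part is governed by the coefficient of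
`t ^ (2g)` in `t / sinh t`, a nonzero multiple of the Bernoulli number `B_(2g)`, which is nonzero
because `ζ (2g) ≠ 0`.
-/

noncomputable section

namespace Hurwitz

open Equiv MonoidAlgebra

/-! ### Twisted subgroup sums and class averages -/

theorem card_nsmul_sum_smul_eq {G X M : Type*} [Group G] [Fintype G] [Fintype X] [AddCommMonoid M]
    [MulAction G X] [MulAction.IsPretransitive G X] (f : X → M) (x : X) :
    Fintype.card X • ∑ g : G, f (g • x) = Fintype.card G • ∑ y, f y := by
  have hconst : ∀ y : X, ∑ g : G, f (g • y) = ∑ g : G, f (g • x) := by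
    intro y
    obtain ⟨h, rfl⟩ := MulAction.exists_smul_eq G x y
    exact Fintype.sum_equiv (Equiv.mulRight h) _ _ fun g => by simp [mul_smul]
  calc Fintype.card X • ∑ g : G, f (g • x)
      = ∑ y : X, ∑ g : G, f (g • y) := by
        rw [Finset.sum_congr rfl fun y _ => hconst y, Finset.sum_const, Finset.card_univ]
    _ = ∑ g : G, ∑ y : X, f (g • y) := Finset.sum_comm
    _ = Fintype.card G • ∑ y, f y := by
        rw [Finset.sum_congr rfl fun g _ => (MulAction.bijective g).sum_comp f, Finset.sum_const,
          Finset.card_univ]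

section TwistedSum

variable {k G : Type*} [CommRing k] [Group G] [Fintype G]

open Classical in
/-- The sum of the elements of a subgroup weighted by the inverse of a linear character, so that
multiplication by an element of the subgroup scales it by the character. It is `|H|` times the
idempotent of the character. -/
def twistedSum (χ : G →* k) (H : Subgroup G) : MonoidAlgebra k G :=
  ∑ σ : H, χ (σ : G)⁻¹ • of k G σ

theorem of_mul_twistedSum (χ : G →* k) {H : Subgroup G} {σ : G} (hσ : σ ∈ H) :
    of k G σ * twistedSum χ H = χ σ • twistedSum χ H := by
  classical
  rw [twistedSum, Finset.mul_sum, Finset.smul_sum]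
  refine Fintype.sum_equiv (Equiv.mulLeft ⟨σ, hσ⟩) _ _ fun τ => ?_
  have hχ : χ (τ : G)⁻¹ = χ σ * χ (σ * τ)⁻¹ := by
    rw [mul_inv_rev, map_mul, mul_comm, mul_assoc, ← map_mul, inv_mul_cancel, map_one, mul_one]
  rw [mul_smul_comm, hχ, mul_smul, ← map_mul]
  rfl

theorem twistedSum_mul_of (χ : G →* k) {H : Subgroup G} {σ : G} (hσ : σ ∈ H) :
    twistedSum χ H * of k G σ = χ σ • twistedSum χ H := by
  classical
  rw [twistedSum, Finset.sum_mul, Finset.smul_sum]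
  refine Fintype.sum_equiv (Equiv.mulRight ⟨σ, hσ⟩) _ _ fun τ => ?_
  have hχ : χ (τ : G)⁻¹ = χ σ * χ (τ * σ : G)⁻¹ := by
    rw [mul_inv_rev, ← map_mul, mul_inv_cancel_left]
  rw [smul_mul_assoc, hχ, mul_smul, ← map_mul]
  rfl

theorem twistedSum_mul_twistedSum_of_le (χ : G →* k) {H L : Subgroup G} (h : L ≤ H) :
    twistedSum χ H * twistedSum χ L = (Nat.card L : k) • twistedSum χ H := by
  classical
  rw [twistedSum.eq_def χ L, Finset.mul_sum]
  calc ∑ σ : L, twistedSum χ H * χ (σ : G)⁻¹ • of k G σ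
      = ∑ _σ : L, twistedSum χ H := by
        refine Finset.sum_congr rfl fun σ _ => ?_
        rw [mul_smul_comm, twistedSum_mul_of χ (h σ.2), smul_smul, ← map_mul, inv_mul_cancel,
          map_one, one_smul]
    _ = (Nat.card L : k) • twistedSum χ H := by
        rw [Finset.sum_const, ← Nat.cast_smul_eq_nsmul k, Nat.card_eq_fintype_card,
          Finset.card_univ]

theorem commute_twistedSum (χ : G →* k) {H : Subgroup G} {u : MonoidAlgebra k G}
    (h : ∀ σ ∈ H, Commute u (of k G σ)) : Commute u (twistedSum χ H) :=
  Commute.sum_right _ _ _ fun σ _ => (h σ σ.2).smul_right _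

theorem commute_twistedSum_of_mem (χ : G →* k) {H : Subgroup G} {σ : G} (hσ : σ ∈ H) :
    Commute (twistedSum χ H) (of k G σ) :=
  (twistedSum_mul_of χ hσ).trans (of_mul_twistedSum χ hσ).symm

theorem twistedSum_eq_mul_sum (χ : G →* k) {ι : Type*} [Fintype ι] {H L : Subgroup G} {t : ι → G}
    (e : H ≃ L × ι) (he : ∀ σ : H, (σ : G) = (e σ).1 * t (e σ).2) :
    twistedSum χ H = twistedSum χ L * ∑ i, χ (t i)⁻¹ • of k G (t i) := by
  classical
  rw [twistedSum, twistedSum, Fintype.sum_mul_sum, ← Fintype.sum_prod_type']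
  refine Fintype.sum_equiv e _ _ fun σ => ?_
  rw [he σ, smul_mul_smul_comm, map_mul, mul_inv_rev, map_mul, mul_comm (χ _)]

theorem twistedSum_mul_of_mul_twistedSum_eq_zero [IsDomain k] {χ ψ : G →* k} {H L : Subgroup G}
    {ρ τ : G} (hρ : ρ ∈ H) (hτ : τ⁻¹ * ρ * τ ∈ L) (h : χ ρ ≠ ψ ρ) :
    twistedSum χ H * of k G τ * twistedSum ψ L = 0 := by
  have hψ : ψ (τ⁻¹ * ρ * τ) = ψ ρ := by
    rw [mul_assoc, map_mul, mul_comm, ← map_mul, mul_inv_cancel_right]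
  have hτ' : of k G ρ * of k G τ = of k G τ * of k G (τ⁻¹ * ρ * τ) := by
    rw [← map_mul, ← map_mul, mul_assoc, mul_inv_cancel_left]
  have key : χ ρ • (twistedSum χ H * of k G τ * twistedSum ψ L)
      = ψ ρ • (twistedSum χ H * of k G τ * twistedSum ψ L) := by
    calc χ ρ • (twistedSum χ H * of k G τ * twistedSum ψ L)
        = twistedSum χ H * (of k G ρ * of k G τ) * twistedSum ψ L := by
          rw [← mul_assoc, twistedSum_mul_of χ hρ, smul_mul_assoc, smul_mul_assoc]
      _ = twistedSum χ H * of k G τ * (of k G (τ⁻¹ * ρ * τ) * twistedSum ψ L) := by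
          rw [hτ']; simp only [mul_assoc]
      _ = ψ ρ • (twistedSum χ H * of k G τ * twistedSum ψ L) := by
          rw [of_mul_twistedSum ψ hτ, hψ, mul_smul_comm]
  rw [← sub_eq_zero, ← sub_smul] at key
  ext σ
  have hσ := congrArg (fun u : MonoidAlgebra k G => u.coeff σ) key
  simpa [sub_ne_zero.2 h] using hσ

open Classical in
theorem coeff_twistedSum_mul_twistedSum (χ ψ : G →* k) (H L : Subgroup G) (ρ : G) :
    (twistedSum χ H * twistedSum ψ L).coeff ρ
      = ∑ p : H × L, if (p.1 * p.2 : G) = ρ then χ (p.1 : G)⁻¹ * ψ (p.2 : G)⁻¹ else 0 := by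
  classical
  rw [twistedSum, twistedSum, Fintype.sum_mul_sum, ← Fintype.sum_prod_type', coeff_sum,
    Finset.sum_apply']
  refine Finset.sum_congr rfl fun p _ => ?_
  rw [smul_mul_smul_comm, ← map_mul, coeff_smul, Finsupp.smul_apply, of_apply, coeff_single,
    Finsupp.single_apply, smul_ite, smul_eq_mul, mul_one, smul_zero]

theorem coeff_twistedSum_mul_twistedSum_of_disjoint (χ ψ : G →* k) {H L : Subgroup G}
    (h : Disjoint H L) {σ τ : G} (hσ : σ ∈ H) (hτ : τ ∈ L) :
    (twistedSum χ H * twistedSum ψ L).coeff (σ * τ) = χ σ⁻¹ * ψ τ⁻¹ := by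
  classical
  rw [coeff_twistedSum_mul_twistedSum, Fintype.sum_eq_single (⟨σ, hσ⟩, ⟨τ, hτ⟩), if_pos rfl]
  exact fun p hp => if_neg fun hp' => hp (Subgroup.mul_injective_of_disjoint h hp')

theorem coeff_twistedSum_mul_twistedSum_eq_zero (χ ψ : G →* k) {H L : Subgroup G} {ρ : G}
    (h : ∀ σ ∈ H, ∀ τ ∈ L, σ * τ ≠ ρ) : (twistedSum χ H * twistedSum ψ L).coeff ρ = 0 := by
  classical
  rw [coeff_twistedSum_mul_twistedSum]
  exact Finset.sum_eq_zero fun p _ => if_neg (h _ p.1.2 _ p.2.2)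

/-- The sum of the coefficients of an element of the group algebra over the conjugates of a group
element, each conjugate counted as often as the order of the centralizer. -/
def classAverage (σ : G) : MonoidAlgebra k G →ₗ[k] k :=
  ∑ τ : G, Finsupp.lapply (τ⁻¹ * σ * τ) ∘ₗ (coeffLinearEquiv k).toLinearMap

theorem classAverage_apply (σ : G) (u : MonoidAlgebra k G) :
    classAverage σ u = ∑ τ : G, u.coeff (τ⁻¹ * σ * τ) := by
  simp [classAverage, LinearMap.sum_apply]

theorem classAverage_of_mul (σ π : G) (u : MonoidAlgebra k G) :
    classAverage σ (of k G π * u) = classAverage σ (u * of k G π) := by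
  simp only [classAverage_apply, of_apply, coeff_single_mul_apply, coeff_mul_single_apply, one_mul,
    mul_one]
  exact Fintype.sum_equiv (Equiv.mulRight π) _ _ fun τ => by simp [mul_assoc]

theorem classAverage_mul_comm (σ : G) (u v : MonoidAlgebra k G) :
    classAverage σ (u * v) = classAverage σ (v * u) := by
  induction u using MonoidAlgebra.induction_on with
  | of π => exact classAverage_of_mul σ π v
  | add x y hx hy => simp only [add_mul, mul_add, map_add, hx, hy]
  | smul r x hx => simp only [smul_mul_assoc, mul_smul_comm, map_smul, hx]

theorem classAverage_mul_of_conj (σ π : G) {ρ : G} {u : MonoidAlgebra k G}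
    (h : Commute u (of k G ρ)) :
    classAverage σ (u * of k G (ρ * π * ρ⁻¹)) = classAverage σ (u * of k G π) := by
  calc classAverage σ (u * of k G (ρ * π * ρ⁻¹))
      = classAverage σ (of k G ρ⁻¹ * (of k G ρ * u * of k G π)) := by
        rw [← h.eq, classAverage_of_mul, mul_assoc u, mul_assoc u, ← map_mul, ← map_mul]
    _ = classAverage σ (u * of k G π) := by
        rw [mul_assoc, ← mul_assoc, ← map_mul, inv_mul_cancel, map_one, one_mul]

/-- The sum of all conjugates of an element of the group algebra. -/
def conjSum (u : MonoidAlgebra k G) : MonoidAlgebra k G :=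
  ∑ τ : G, of k G τ * u * of k G τ⁻¹

theorem coeff_conjSum (u : MonoidAlgebra k G) (σ : G) :
    (conjSum u).coeff σ = classAverage σ u := by
  rw [conjSum, coeff_sum, Finset.sum_apply', classAverage_apply]
  refine Finset.sum_congr rfl fun τ _ => ?_
  simp [of_apply, coeff_single_mul_apply, coeff_mul_single_apply, mul_assoc]

theorem conjSum_mul_comm (u v : MonoidAlgebra k G) : conjSum (u * v) = conjSum (v * u) := by
  ext σ
  rw [coeff_conjSum, coeff_conjSum, classAverage_mul_comm]

theorem commute_conjSum (u v : MonoidAlgebra k G) : Commute (conjSum u) v := by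
  induction v using MonoidAlgebra.induction_on with
  | of π =>
    rw [commute_iff_eq, conjSum, Finset.sum_mul, Finset.mul_sum]
    refine Fintype.sum_equiv (Equiv.mulLeft π⁻¹) _ _ fun τ => ?_
    simp only [Equiv.coe_mulLeft, mul_inv_rev, inv_inv, map_mul, ← mul_assoc]
    rw [← map_mul, mul_inv_cancel, map_one, one_mul]
  | add x y hx hy => exact hx.add_right hy
  | smul r x hx => exact hx.smul_right r

end TwistedSum

/-! ### Characters of principal left ideals -/

section LeftIdeal

variable {k G : Type*} [Group G]

/-- Left multiplication on the left ideal generated by an element of the group algebra; the Specht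
representation is the case of a Young symmetrizer. -/
def leftIdealRep [CommRing k] (c : MonoidAlgebra k G) :
    Representation k G (Ideal.span {c} : Ideal (MonoidAlgebra k G)) :=
  (Algebra.lsmul k k (Ideal.span {c} : Ideal (MonoidAlgebra k G))).toMonoidHom.comp (of k G)

variable [Fintype G]

theorem trace_mulLeft_comp_mulRight [CommRing k] (e : MonoidAlgebra k G) (σ : G) :
    LinearMap.trace k (MonoidAlgebra k G)
      (LinearMap.mulLeft k (of k G σ) ∘ₗ LinearMap.mulRight k e) = classAverage σ⁻¹ e := by
  classical
  rw [LinearMap.trace_eq_matrix_trace k (MonoidAlgebra.basis G k), Matrix.trace,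
    classAverage_apply]
  refine Finset.sum_congr rfl fun τ _ => ?_
  rw [Matrix.diag_apply, LinearMap.toMatrix_apply]
  simp [MonoidAlgebra.basis, of_apply, coeff_single_mul_apply, mul_assoc]

/-- Right multiplication by the idempotent `h⁻¹ • c` projects the group algebra onto the left
ideal, so the character is a trace on the whole group algebra. -/
theorem character_leftIdealRep [Field k] {c : MonoidAlgebra k G} {h : k} (hh : h ≠ 0)
    (hc : c * c = h • c) (σ : G) :
    (leftIdealRep c).character σ = classAverage σ⁻¹ c / h := by
  set p : Submodule k (MonoidAlgebra k G) :=
    (Ideal.span {c} : Ideal (MonoidAlgebra k G)).restrictScalars k with hp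
  set f := LinearMap.mulLeft k (of k G σ) ∘ₗ LinearMap.mulRight k (h⁻¹ • c) with hf
  have hmem : ∀ x, f x ∈ p := by
    intro x
    rw [hp, Submodule.restrictScalars_mem, hf, LinearMap.comp_apply, LinearMap.mulLeft_apply,
      LinearMap.mulRight_apply, Ideal.mem_span_singleton']
    exact ⟨h⁻¹ • (of k G σ * x), by simp [mul_assoc]⟩
  have hrestrict : leftIdealRep c σ = f.restrict (p := p) (q := p) fun x _ => hmem x := by
    ext ⟨x, hx⟩ : 2
    obtain ⟨y, rfl⟩ := Ideal.mem_span_singleton'.1 hx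
    change of k G σ * (y * c) = of k G σ * (y * c * (h⁻¹ • c))
    rw [mul_assoc y, mul_smul_comm, hc, smul_smul, inv_mul_cancel₀ hh, one_smul]
  calc (leftIdealRep c).character σ
      = LinearMap.trace k p (f.restrict fun x _ => hmem x) :=
        congrArg (LinearMap.trace k p) hrestrict
    _ = LinearMap.trace k (MonoidAlgebra k G) f :=
        LinearMap.trace_restrict_eq_of_forall_mem p f hmem
    _ = classAverage σ⁻¹ c / h := by
        rw [hf, trace_mulLeft_comp_mulRight, map_smul, smul_eq_mul, inv_mul_eq_div]

theorem sum_coeff_smul_leftIdealRep_apply [CommRing k] (c z : MonoidAlgebra k G)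
    (x : (Ideal.span {c} : Ideal (MonoidAlgebra k G))) :
    (((∑ σ : G, z.coeff σ • leftIdealRep c σ) x : _) : MonoidAlgebra k G) = z * x := by
  have hz : z = ∑ σ : G, z.coeff σ • of k G σ := by
    classical
    ext τ
    rw [coeff_sum, Finset.sum_apply']
    simp [of_apply, Finsupp.single_apply]
  conv_rhs => rw [hz, Finset.sum_mul]
  rw [LinearMap.sum_apply, AddSubmonoidClass.coe_finsetSum]
  exact Finset.sum_congr rfl fun σ _ => (smul_mul_assoc _ _ _).symm

theorem sum_coeff_mul_character_leftIdealRep_eq_zero [Field k] {c z : MonoidAlgebra k G}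
    (hz : ∀ u, Commute z u) (h : z * c = 0) :
    ∑ σ : G, z.coeff σ * (leftIdealRep c).character σ = 0 := by
  have hzero : ∑ σ : G, z.coeff σ • leftIdealRep c σ = 0 := by
    ext x : 2
    obtain ⟨y, hy⟩ := Ideal.mem_span_singleton'.1 x.2
    rw [sum_coeff_smul_leftIdealRep_apply, ← hy, ← mul_assoc, (hz y).eq, mul_assoc, h, mul_zero,
      LinearMap.zero_apply, ZeroMemClass.coe_zero]
  have htrace := congrArg (LinearMap.trace k _) hzero
  rw [map_sum, map_zero] at htrace
  rw [← htrace]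
  refine Finset.sum_congr rfl fun σ _ => ?_
  rw [map_smul, smul_eq_mul]
  rfl

end LeftIdeal

/-! ### Symmetrizers and antisymmetrizers of finite sets -/

section PermsOn

variable {α : Type*}

/-- The permutations moving only points of a finite set, i.e. the symmetric group of that set
inside the symmetric group of the ambient type. -/
def permsOn (S : Finset α) : Subgroup (Perm α) :=
  fixingSubgroup (Perm α) (S : Set α)ᶜ

theorem mem_permsOn {S : Finset α} {σ : Perm α} : σ ∈ permsOn S ↔ ∀ a ∉ S, σ a = a := by
  simp [permsOn, mem_fixingSubgroup_iff]

theorem permsOn_mono {S T : Finset α} (h : S ⊆ T) : permsOn S ≤ permsOn T :=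
  fixingSubgroup_antitone _ _ (Set.compl_subset_compl.2 (Finset.coe_subset.2 h))

theorem apply_mem_iff_of_mem_permsOn {S : Finset α} {σ : Perm α} (hσ : σ ∈ permsOn S) (a : α) :
    σ a ∈ S ↔ a ∈ S := by
  rw [mem_permsOn] at hσ
  refine not_iff_not.1 ⟨fun h => ?_, fun h => by rwa [hσ a h]⟩
  rwa [σ.injective (hσ _ h)] at h

theorem commute_of_mem_permsOn {S T : Finset α} (h : Disjoint S T) {σ τ : Perm α}
    (hσ : σ ∈ permsOn S) (hτ : τ ∈ permsOn T) : Commute σ τ := by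
  classical
  refine Perm.Disjoint.commute fun a => ?_
  by_cases ha : a ∈ S
  · exact Or.inr (mem_permsOn.1 hτ a (Finset.disjoint_left.1 h ha))
  · exact Or.inl (mem_permsOn.1 hσ a ha)

theorem disjoint_permsOn {S T : Finset α} (h : Disjoint S T) :
    Disjoint (permsOn S) (permsOn T) := by
  rw [Subgroup.disjoint_def]
  refine fun {σ} hS hT => Perm.ext fun a => ?_
  by_cases ha : a ∈ S
  · exact mem_permsOn.1 hT a (Finset.disjoint_left.1 h ha)
  · exact mem_permsOn.1 hS a ha

theorem card_permsOn (S : Finset α) : Nat.card (permsOn S) = S.card.factorial := by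
  classical
  have e : Perm S ≃ permsOn S := (Perm.subtypeEquivSubtypePerm (· ∈ S)).trans
    (Equiv.subtypeEquivRight fun _ => mem_permsOn.symm)
  rw [← Nat.card_congr e, Nat.card_eq_fintype_card, Fintype.card_perm, Fintype.card_coe]

variable [DecidableEq α]

theorem swap_mem_permsOn {S : Finset α} {x y : α} (hx : x ∈ S) (hy : y ∈ S) :
    swap x y ∈ permsOn S :=
  mem_permsOn.2 fun _ ha =>
    swap_apply_of_ne_of_ne (ne_of_mem_of_not_mem hx ha).symm (ne_of_mem_of_not_mem hy ha).symm

/-- The coset decomposition `σ ↦ (σ * swap x (σ⁻¹ x), σ⁻¹ x)` of the permutations of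
`insert x S` over those of `S`. -/
def permsOnInsertEquiv {x : α} {S : Finset α} (hx : x ∉ S) :
    permsOn (insert x S) ≃ permsOn S × (insert x S : Finset α) where
  toFun σ :=
    have hy : (σ : Perm α)⁻¹ x ∈ insert x S :=
      (apply_mem_iff_of_mem_permsOn (inv_mem σ.2) x).2 (Finset.mem_insert_self x S)
    (⟨σ * swap x ((σ : Perm α)⁻¹ x), mem_permsOn.2 fun a ha => by
      by_cases hax : a = x
      · simp [hax]
      · have ha' : a ∉ insert x S := by simp [hax, ha]
        rw [Perm.mul_apply, swap_apply_of_ne_of_ne hax (ne_of_mem_of_not_mem hy ha').symm,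
          mem_permsOn.1 σ.2 a ha']⟩, ⟨(σ : Perm α)⁻¹ x, hy⟩)
  invFun p := ⟨p.1 * swap x p.2, mul_mem (permsOn_mono (Finset.subset_insert x S) p.1.2)
    (swap_mem_permsOn (Finset.mem_insert_self x S) p.2.2)⟩
  left_inv σ := by simp [mul_assoc]
  right_inv p := by
    have hp : (p.1 * swap x p.2 : Perm α)⁻¹ x = p.2 := by
      rw [Perm.inv_eq_iff_eq, Perm.mul_apply, swap_apply_right, mem_permsOn.1 p.1.2 x hx]
    ext1
    · simp only [hp, mul_assoc, swap_mul_self, mul_one]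
    · exact Subtype.ext hp

theorem twistedSum_permsOn_insert {k : Type*} [CommRing k] [Fintype α] (χ : Perm α →* k) {x : α}
    {S : Finset α} (hx : x ∉ S) :
    twistedSum χ (permsOn (insert x S)) = twistedSum χ (permsOn S) *
      (1 + ∑ y ∈ S, χ (swap x y) • of k (Perm α) (swap x y)) := by
  have hdecomp := twistedSum_eq_mul_sum χ (t := fun y : (insert x S : Finset α) => swap x (y : α))
    (permsOnInsertEquiv hx) fun σ => by simp [permsOnInsertEquiv, mul_assoc]
  have hone : χ (swap x x) • of k (Perm α) (swap x x) = 1 := by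
    rw [swap_self, ← Perm.one_def, map_one, map_one, one_smul]
  simp only [swap_inv] at hdecomp
  rw [hdecomp, Finset.sum_coe_sort (insert x S) fun y => χ (swap x y) • of k (Perm α) (swap x y),
    Finset.sum_insert hx, hone]

end PermsOn

section Symmetrizer

variable (k : Type*) {α : Type*} [CommRing k] [DecidableEq α]

/-- The sum of the transpositions exchanging a point with the points of a finite set: a
Jucys–Murphy element of the symmetric group of `insert x S`. -/
def starSum (x : α) (S : Finset α) : MonoidAlgebra k (Perm α) :=
  ∑ y ∈ S, of k (Perm α) (swap x y)

theorem commute_starSum {x : α} {S : Finset α} (hx : x ∉ S) {σ : Perm α} (hσ : σ ∈ permsOn S) :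
    Commute (starSum k x S) (of k (Perm α) σ) := by
  rw [commute_iff_eq, starSum, Finset.sum_mul, Finset.mul_sum]
  refine Finset.sum_bij' (fun y _ => σ⁻¹ y) (fun y _ => σ y) ?_ ?_ ?_ ?_ ?_
  · exact fun y hy => (apply_mem_iff_of_mem_permsOn (inv_mem hσ) y).2 hy
  · exact fun y hy => (apply_mem_iff_of_mem_permsOn hσ y).2 hy
  · simp
  · simp
  · intro y _
    rw [← map_mul, ← map_mul, Equiv.mul_swap_eq_swap_mul, mem_permsOn.1 hσ x hx,
      ← Perm.mul_apply, mul_inv_cancel, Perm.one_apply]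

variable [Fintype α]

/-- The sign character of a symmetric group with values in a commutative ring. -/
def signHom : Perm α →* k :=
  (Int.castRingHom k : ℤ →* k).comp ((Units.coeHom ℤ).comp Perm.sign)

theorem signHom_swap {x y : α} (h : x ≠ y) : signHom k (swap x y) = -1 := by
  simp [signHom, Perm.sign_swap h]

theorem signHom_of_isCycle {σ : Perm α} (h : σ.IsCycle) :
    signHom k σ = -(-1) ^ σ.support.card := by
  simp [signHom, h.sign]

theorem signHom_inv (σ : Perm α) : signHom k σ⁻¹ = signHom k σ := by
  simp [signHom]

/-- The sum of all permutations of a finite subset, as an element of the group algebra of the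
ambient symmetric group. -/
def symmetrizer (S : Finset α) : MonoidAlgebra k (Perm α) :=
  twistedSum 1 (permsOn S)

/-- The signed sum of all permutations of a finite subset, as an element of the group algebra of
the ambient symmetric group. -/
def antisymmetrizer (S : Finset α) : MonoidAlgebra k (Perm α) :=
  twistedSum (signHom k) (permsOn S)

theorem symmetrizer_insert {x : α} {S : Finset α} (hx : x ∉ S) :
    symmetrizer k (insert x S) = (1 + starSum k x S) * symmetrizer k S := by
  have hcomm : Commute (1 + starSum k x S) (symmetrizer k S) :=
    (Commute.one_left _).add_left (commute_twistedSum _ fun _ hσ => commute_starSum k hx hσ)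
  rw [hcomm.eq, symmetrizer, twistedSum_permsOn_insert 1 hx, symmetrizer, starSum]
  simp only [MonoidHom.one_apply, one_smul]

theorem commute_one_sub_starSum_antisymmetrizer {x : α} {S : Finset α} (hx : x ∉ S) :
    Commute (1 - starSum k x S) (antisymmetrizer k S) :=
  (Commute.one_left _).sub_left (commute_twistedSum _ fun _ hσ => commute_starSum k hx hσ)

theorem antisymmetrizer_insert {x : α} {S : Finset α} (hx : x ∉ S) :
    antisymmetrizer k (insert x S) = antisymmetrizer k S * (1 - starSum k x S) := by
  rw [antisymmetrizer, twistedSum_permsOn_insert _ hx, antisymmetrizer, starSum, sub_eq_add_neg,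
    ← Finset.sum_neg_distrib]
  congr 2
  refine Finset.sum_congr rfl fun y hy => ?_
  rw [signHom_swap k (ne_of_mem_of_not_mem hy hx).symm, neg_one_smul]

theorem antisymmetrizer_insert' {x : α} {S : Finset α} (hx : x ∉ S) :
    antisymmetrizer k (insert x S) = (1 - starSum k x S) * antisymmetrizer k S := by
  rw [antisymmetrizer_insert k hx, (commute_one_sub_starSum_antisymmetrizer k hx).eq]

theorem symmetrizer_mul_of {S : Finset α} {σ : Perm α} (hσ : σ ∈ permsOn S) :
    symmetrizer k S * of k (Perm α) σ = symmetrizer k S := by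
  rw [symmetrizer, twistedSum_mul_of _ hσ, MonoidHom.one_apply, one_smul]

theorem antisymmetrizer_mul_swap {S : Finset α} {x y : α} (hx : x ∈ S) (hy : y ∈ S) (h : x ≠ y) :
    antisymmetrizer k S * of k (Perm α) (swap x y) = -antisymmetrizer k S := by
  rw [antisymmetrizer, twistedSum_mul_of _ (swap_mem_permsOn hx hy), signHom_swap k h,
    neg_one_smul]

theorem symmetrizer_mul_symmetrizer_of_subset {S T : Finset α} (h : T ⊆ S) :
    symmetrizer k S * symmetrizer k T = (T.card.factorial : k) • symmetrizer k S := by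
  rw [symmetrizer, symmetrizer, twistedSum_mul_twistedSum_of_le _ (permsOn_mono h), card_permsOn]

theorem antisymmetrizer_mul_antisymmetrizer_of_subset {S T : Finset α} (h : T ⊆ S) :
    antisymmetrizer k S * antisymmetrizer k T = (T.card.factorial : k) • antisymmetrizer k S := by
  rw [antisymmetrizer, antisymmetrizer, twistedSum_mul_twistedSum_of_le _ (permsOn_mono h),
    card_permsOn]

theorem commute_twistedSum_permsOn_of (χ : Perm α →* k) {S T : Finset α} (h : Disjoint S T)
    {σ : Perm α} (hσ : σ ∈ permsOn T) :
    Commute (twistedSum χ (permsOn S)) (of k (Perm α) σ) :=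
  (commute_twistedSum χ fun _ hτ => (commute_of_mem_permsOn h hτ hσ).symm.map (of k _)).symm

theorem commute_symmetrizer_antisymmetrizer {S T : Finset α} (h : Disjoint S T) :
    Commute (symmetrizer k S) (antisymmetrizer k T) :=
  commute_twistedSum _ fun _ hσ => commute_twistedSum_permsOn_of k 1 h hσ

end Symmetrizer

/-! ### The Young symmetrizer of a hook -/

section Hook

variable (k : Type*) {α : Type*} [CommRing k] [DecidableEq α] [Fintype α]

/-- The Young symmetrizer of the hook with row `P` and column `insert x K`, where `x ∈ P` is the
corner cell and `K` is disjoint from `P`. -/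
def hookSymmetrizer (P K : Finset α) (x : α) : MonoidAlgebra k (Perm α) :=
  symmetrizer k P * antisymmetrizer k (insert x K)

theorem symmetrizer_mul_swap_mul_antisymmetrizer [IsDomain k] [CharZero k] {P C : Finset α}
    {x y z : α} (hxP : x ∈ P) (hxC : x ∈ C) (hy : y ∈ P) (hz : z ∈ C) (hxy : x ≠ y) (hxz : x ≠ z) :
    symmetrizer k P * of k (Perm α) (swap y z) * antisymmetrizer k C = 0 := by
  refine twistedSum_mul_of_mul_twistedSum_eq_zero (swap_mem_permsOn hxP hy) ?_ ?_
  · have hconj : (swap y z)⁻¹ * swap x y * swap y z = swap x z := by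
      rw [← inv_inv (swap y z), inv_inv (swap y z)⁻¹, ← swap_apply_apply, swap_inv,
        swap_apply_left, swap_apply_of_ne_of_ne hxy hxz]
    rw [hconj]
    exact swap_mem_permsOn hxC hz
  · rw [signHom_swap k hxy, MonoidHom.one_apply]
    exact self_ne_neg.2 one_ne_zero

theorem antisymmetrizer_mul_swap_mul_one_sub_starSum {K : Finset α} {x y : α} (hx : x ∉ K)
    (hy : y ∉ K) (hxy : x ≠ y) :
    antisymmetrizer k (insert x K) * of k (Perm α) (swap x y) * (1 - starSum k x K)
      = starSum k y (insert x K) * antisymmetrizer k (insert x K) := by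
  have hcomm : Commute (starSum k y (insert x K)) (antisymmetrizer k (insert x K)) :=
    commute_twistedSum _ fun _ hσ => commute_starSum k (by simp [hy, hxy.symm]) hσ
  rw [hcomm.eq, mul_sub, mul_one, starSum, starSum, Finset.sum_insert hx, mul_add, swap_comm y x,
    sub_eq_add_neg, Finset.mul_sum, Finset.mul_sum, ← Finset.sum_neg_distrib]
  congr 1
  refine Finset.sum_congr rfl fun z hz => ?_
  have hxz : x ≠ z := (ne_of_mem_of_not_mem hz hx).symm
  have hyz : y ≠ z := (ne_of_mem_of_not_mem hz hy).symm
  have hswap : swap x y * swap x z = swap x z * swap y z := by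
    rw [Equiv.mul_swap_eq_swap_mul (swap x z), swap_apply_right,
      swap_apply_of_ne_of_ne hxy.symm hyz, swap_comm y x]
  rw [mul_assoc, ← map_mul, hswap, map_mul, ← mul_assoc,
    antisymmetrizer_mul_swap k (by simp) (by simp [hz]) hxz, neg_mul, neg_neg]

theorem symmetrizer_mul_starSum_mul_antisymmetrizer [IsDomain k] [CharZero k] {P K : Finset α}
    {x y : α} (hPK : Disjoint P K) (hx : x ∈ P) (hy : y ∈ P) (hxy : x ≠ y) :
    symmetrizer k P * starSum k y (insert x K) * antisymmetrizer k (insert x K)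
      = hookSymmetrizer k P K x := by
  have hxK : x ∉ K := Finset.disjoint_left.1 hPK hx
  rw [starSum, Finset.sum_insert hxK, mul_add, add_mul,
    symmetrizer_mul_of k (swap_mem_permsOn hy hx), Finset.mul_sum, Finset.sum_mul,
    Finset.sum_eq_zero, add_zero, hookSymmetrizer]
  exact fun z hz => symmetrizer_mul_swap_mul_antisymmetrizer k hx (by simp) hy (by simp [hz]) hxy
    (ne_of_mem_of_not_mem hz hxK).symm

theorem hookSymmetrizer_mul_swap_mul_antisymmetrizer [IsDomain k] [CharZero k] {P K : Finset α}
    {x y : α} (hPK : Disjoint P K) (hx : x ∈ P) (hy : y ∈ P) (hxy : x ≠ y) :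
    hookSymmetrizer k P K x * of k (Perm α) (swap x y) * antisymmetrizer k (insert x K)
      = (K.card.factorial : k) • hookSymmetrizer k P K x := by
  have hxK : x ∉ K := Finset.disjoint_left.1 hPK hx
  have hyK : y ∉ K := Finset.disjoint_left.1 hPK hy
  calc hookSymmetrizer k P K x * of k (Perm α) (swap x y) * antisymmetrizer k (insert x K)
      = symmetrizer k P * (antisymmetrizer k (insert x K) * of k (Perm α) (swap x y) *
          (1 - starSum k x K)) * antisymmetrizer k K := by
        rw [hookSymmetrizer]
        nth_rw 2 [antisymmetrizer_insert' k hxK]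
        simp only [mul_assoc]
    _ = hookSymmetrizer k P K x * antisymmetrizer k K := by
        rw [antisymmetrizer_mul_swap_mul_one_sub_starSum k hxK hyK hxy, ← mul_assoc,
          symmetrizer_mul_starSum_mul_antisymmetrizer k hPK hx hy hxy]
    _ = (K.card.factorial : k) • hookSymmetrizer k P K x := by
        rw [hookSymmetrizer, mul_assoc, antisymmetrizer_mul_antisymmetrizer_of_subset k
          (Finset.subset_insert x K), mul_smul_comm]

theorem hookSymmetrizer_mul_one_add_starSum [IsDomain k] [CharZero k] {P K : Finset α} {x : α}
    (hPK : Disjoint P K) (hx : x ∈ P) :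
    hookSymmetrizer k P K x * (1 + starSum k x (P.erase x)) * antisymmetrizer k (insert x K)
      = (K.card.factorial * (P.card + K.card) : k) • hookSymmetrizer k P K x := by
  have hone : hookSymmetrizer k P K x * antisymmetrizer k (insert x K)
      = ((K.card + 1).factorial : k) • hookSymmetrizer k P K x := by
    rw [hookSymmetrizer, mul_assoc, antisymmetrizer_mul_antisymmetrizer_of_subset k subset_rfl,
      mul_smul_comm, Finset.card_insert_of_notMem (Finset.disjoint_left.1 hPK hx)]
  have hswap : ∀ y ∈ P.erase x,
      hookSymmetrizer k P K x * of k (Perm α) (swap x y) * antisymmetrizer k (insert x K)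
        = (K.card.factorial : k) • hookSymmetrizer k P K x := fun y hy =>
    hookSymmetrizer_mul_swap_mul_antisymmetrizer k hPK hx (Finset.mem_of_mem_erase hy)
      (Finset.ne_of_mem_erase hy).symm
  have hcard : P.card = (P.erase x).card + 1 := (Finset.card_erase_add_one hx).symm
  rw [mul_add, add_mul, mul_one, hone, starSum, Finset.mul_sum, Finset.sum_mul,
    Finset.sum_congr rfl hswap, Finset.sum_const, ← Nat.cast_smul_eq_nsmul k, smul_smul,
    ← add_smul, hcard, Nat.factorial_succ]
  push_cast
  congr 1
  ring

theorem hookSymmetrizer_mul_self [IsDomain k] [CharZero k] {P K : Finset α} {x : α}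
    (hPK : Disjoint P K) (hx : x ∈ P) :
    hookSymmetrizer k P K x * hookSymmetrizer k P K x
      = (K.card.factorial * (P.card - 1).factorial * (P.card + K.card) : k) •
        hookSymmetrizer k P K x := by
  have hxE : x ∉ P.erase x := Finset.notMem_erase x P
  have hcomm : Commute (symmetrizer k (P.erase x)) (antisymmetrizer k (insert x K)) :=
    commute_symmetrizer_antisymmetrizer k (Finset.disjoint_insert_right.2
      ⟨hxE, hPK.mono_left (Finset.erase_subset x P)⟩)
  have hrow : hookSymmetrizer k P K x * symmetrizer k (P.erase x)
      = ((P.card - 1).factorial : k) • hookSymmetrizer k P K x := by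
    rw [hookSymmetrizer, mul_assoc, ← hcomm.eq, ← mul_assoc,
      symmetrizer_mul_symmetrizer_of_subset k (Finset.erase_subset x P), smul_mul_assoc,
      Finset.card_erase_of_mem hx]
  calc hookSymmetrizer k P K x * hookSymmetrizer k P K x
      = hookSymmetrizer k P K x * (1 + starSum k x (P.erase x)) *
          (symmetrizer k (P.erase x) * antisymmetrizer k (insert x K)) := by
        nth_rw 2 [hookSymmetrizer]
        nth_rw 2 [← Finset.insert_erase hx]
        rw [symmetrizer_insert k hxE]
        simp only [mul_assoc]
    _ = hookSymmetrizer k P K x * (1 + starSum k x (P.erase x)) * antisymmetrizer k (insert x K) *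
          symmetrizer k (P.erase x) := by
        rw [hcomm.eq, ← mul_assoc]
    _ = _ := by
        rw [hookSymmetrizer_mul_one_add_starSum k hPK hx, smul_mul_assoc, hrow, smul_smul]
        congr 1
        ring

end Hook

/-! ### Recursion between neighbouring hooks -/

section Recursion

variable (k : Type*) {α : Type*} [CommRing k] [DecidableEq α] [Fintype α]

theorem classAverage_mul_swap_eq {P K : Finset α} (hPK : Disjoint P K) {x x' z z' : α}
    (hx : x ∈ P) (hx' : x' ∈ P) (hz : z ∈ K) (hz' : z' ∈ K) (σ : Perm α) :
    classAverage σ (symmetrizer k P * antisymmetrizer k K * of k (Perm α) (swap x' z'))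
      = classAverage σ (symmetrizer k P * antisymmetrizer k K * of k (Perm α) (swap x z)) := by
  have hne : ∀ {a b : α}, a ∈ P → b ∈ K → a ≠ b := fun ha hb =>
    ne_of_mem_of_not_mem ha (Finset.disjoint_right.1 hPK hb)
  have hP : Commute (symmetrizer k P * antisymmetrizer k K) (of k (Perm α) (swap x x')) :=
    (commute_twistedSum_of_mem 1 (swap_mem_permsOn hx hx')).mul_left
      (commute_twistedSum_permsOn_of k _ hPK.symm (swap_mem_permsOn hx hx'))
  have hK : Commute (symmetrizer k P * antisymmetrizer k K) (of k (Perm α) (swap z z')) :=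
    (commute_twistedSum_permsOn_of k 1 hPK (swap_mem_permsOn hz hz')).mul_left
      (commute_twistedSum_of_mem _ (swap_mem_permsOn hz hz'))
  set ρ := swap x x' * swap z z' with hρ
  have hx'ρ : ρ x = x' := by
    rw [hρ, Perm.mul_apply, swap_apply_of_ne_of_ne (hne hx hz) (hne hx hz'), swap_apply_left]
  have hz'ρ : ρ z = z' := by
    rw [hρ, Perm.mul_apply, swap_apply_left,
      swap_apply_of_ne_of_ne (hne hx hz').symm (hne hx' hz').symm]
  have hcomm : Commute (symmetrizer k P * antisymmetrizer k K) (of k (Perm α) ρ) := by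
    rw [hρ, map_mul]
    exact hP.mul_right hK
  rw [← classAverage_mul_of_conj σ (swap x z) hcomm, ← swap_apply_apply, hx'ρ, hz'ρ]

theorem classAverage_hookSymmetrizer {P K : Finset α} {x z : α} (hPK : Disjoint P K) (hx : x ∈ P)
    (hz : z ∈ K) (σ : Perm α) :
    classAverage σ (hookSymmetrizer k P K x)
      = classAverage σ (symmetrizer k P * antisymmetrizer k K) - (K.card : k) *
        classAverage σ (symmetrizer k P * antisymmetrizer k K * of k (Perm α) (swap x z)) := by
  rw [hookSymmetrizer, antisymmetrizer_insert k (Finset.disjoint_left.1 hPK hx), mul_sub, mul_one,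
    mul_sub, map_sub, starSum, Finset.mul_sum, Finset.mul_sum, map_sum, ← nsmul_eq_mul,
    ← Finset.sum_const, sub_right_inj]
  refine Finset.sum_congr rfl fun z' hz' => ?_
  rw [← mul_assoc]
  exact classAverage_mul_swap_eq k hPK hx hx hz hz' σ

theorem classAverage_hookSymmetrizer_insert {P K : Finset α} {x z : α} (hPK : Disjoint P K)
    (hx : x ∈ P) (hz : z ∈ K) (σ : Perm α) :
    classAverage σ (hookSymmetrizer k (insert z P) (K.erase z) z)
      = classAverage σ (symmetrizer k P * antisymmetrizer k K) + (P.card : k) *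
        classAverage σ (symmetrizer k P * antisymmetrizer k K * of k (Perm α) (swap x z)) := by
  rw [hookSymmetrizer, Finset.insert_erase hz,
    symmetrizer_insert k (Finset.disjoint_right.1 hPK hz), add_mul, one_mul, add_mul, map_add,
    starSum, Finset.sum_mul, Finset.sum_mul, map_sum, ← nsmul_eq_mul, ← Finset.sum_const,
    add_right_inj]
  refine Finset.sum_congr rfl fun y hy => ?_
  rw [mul_assoc, classAverage_of_mul, swap_comm]
  exact classAverage_mul_swap_eq k hPK hx hy hz hz σ

/-- The class-average form of `Ind (1 ⊗ sgn) = χ^hook + χ^(neighbouring hook)`. -/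
theorem classAverage_hookSymmetrizer_recursion {P K : Finset α} {x z : α} (hPK : Disjoint P K)
    (hx : x ∈ P) (hz : z ∈ K) (σ : Perm α) :
    (P.card : k) * classAverage σ (hookSymmetrizer k P K x) +
      (K.card : k) * classAverage σ (hookSymmetrizer k (insert z P) (K.erase z) z)
      = (P.card + K.card : k) * classAverage σ (symmetrizer k P * antisymmetrizer k K) := by
  rw [classAverage_hookSymmetrizer k hPK hx hz, classAverage_hookSymmetrizer_insert k hPK hx hz]
  ring

end Recursion

/-! ### Invariant sets of a permutation -/

section Invariant

open scoped Pointwise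

variable {α : Type*} {σ : Perm α} {B : Finset α}

/-- A finite set is invariant under a permutation if the permutation maps it, and hence its
complement, to itself. -/
def IsInvariant (σ : Perm α) (B : Finset α) : Prop :=
  ∀ a, σ a ∈ B ↔ a ∈ B

variable [DecidableEq α]

theorem IsInvariant.compl [Fintype α] (h : IsInvariant σ B) : IsInvariant σ Bᶜ := fun a => by
  rw [Finset.mem_compl, Finset.mem_compl, h]

theorem IsInvariant.union {B' : Finset α} (h : IsInvariant σ B) (h' : IsInvariant σ B') :
    IsInvariant σ (B ∪ B') := fun a => by
  rw [Finset.mem_union, Finset.mem_union, h, h']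

theorem isInvariant_conj_iff (σ τ : Perm α) (B : Finset α) :
    IsInvariant (τ⁻¹ * σ * τ) B ↔ IsInvariant σ (τ • B) := by
  conv_rhs => rw [IsInvariant, ← τ.forall_congr_right]
  simp only [IsInvariant, ← Finset.inv_smul_mem_iff, Perm.smul_def, Perm.mul_apply,
    Perm.inv_def, symm_apply_apply]

theorem isInvariant_mul_of_mem_permsOn [Fintype α] {r s : Perm α} (hr : r ∈ permsOn Bᶜ)
    (hs : s ∈ permsOn B) : IsInvariant (r * s) B := fun a => by
  have hr' := apply_mem_iff_of_mem_permsOn hr (s a)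
  rwa [Finset.mem_compl, Finset.mem_compl, not_iff_not,
    apply_mem_iff_of_mem_permsOn hs a] at hr'

open Classical in
/-- The permutation agreeing with `σ` on `B` and trivial elsewhere, for `B` invariant under `σ`.
The value for other sets is the identity. -/
def restrictPerm (σ : Perm α) (B : Finset α) : Perm α :=
  if h : IsInvariant σ B then Perm.ofSubtype (σ.subtypePerm h) else 1

theorem restrictPerm_apply (h : IsInvariant σ B) (a : α) :
    restrictPerm σ B a = if a ∈ B then σ a else a := by
  rw [restrictPerm, dif_pos h]
  split_ifs with ha
  · exact Perm.ofSubtype_apply_of_mem _ ha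
  · exact Perm.ofSubtype_apply_of_not_mem _ ha

theorem restrictPerm_mem_permsOn (h : IsInvariant σ B) : restrictPerm σ B ∈ permsOn B :=
  mem_permsOn.2 fun a ha => by rw [restrictPerm_apply h, if_neg ha]

theorem restrictPerm_conj {τ : Perm α} (h : IsInvariant σ (τ • B)) :
    restrictPerm (τ⁻¹ * σ * τ) B = τ⁻¹ * restrictPerm σ (τ • B) * τ := by
  ext a
  change _ = τ⁻¹ (restrictPerm σ (τ • B) (τ • a))
  rw [restrictPerm_apply ((isInvariant_conj_iff σ τ B).2 h), restrictPerm_apply h]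
  have hmem : τ a ∈ τ • B ↔ a ∈ B := Finset.smul_mem_smul_finset_iff τ
  by_cases ha : a ∈ B <;> simp [hmem, ha]

theorem restrictPerm_union {B' : Finset α} (h : IsInvariant σ B) (h' : IsInvariant σ B')
    (hdisj : Disjoint B B') :
    restrictPerm σ (B ∪ B') = restrictPerm σ B * restrictPerm σ B' := by
  ext a
  rw [Perm.mul_apply, restrictPerm_apply (h.union h'), restrictPerm_apply h',
    restrictPerm_apply h]
  by_cases ha : a ∈ B'
  · have hσa : σ a ∉ B := fun hmem => Finset.disjoint_left.1 hdisj ((h a).1 hmem) ha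
    simp [ha, hσa]
  · simp [ha]

theorem restrictPerm_univ [Fintype α] (σ : Perm α) : restrictPerm σ Finset.univ = σ := by
  ext a
  rw [restrictPerm_apply (by simp [IsInvariant]), if_pos (Finset.mem_univ a)]

theorem restrictPerm_compl_mul_restrictPerm [Fintype α] (h : IsInvariant σ B) :
    restrictPerm σ Bᶜ * restrictPerm σ B = σ := by
  rw [← restrictPerm_union h.compl h disjoint_compl_left, Finset.union_comm,
    Finset.union_compl, restrictPerm_univ]

variable (k : Type*) [CommRing k] [Fintype α]

open Classical in
/-- The sign of the restriction of a permutation to an invariant set, zero for other sets. -/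
def restrictSign (σ : Perm α) (B : Finset α) : k :=
  if IsInvariant σ B then signHom k (restrictPerm σ B) else 0

theorem coeff_symmetrizer_compl_mul_antisymmetrizer (K : Finset α) (σ : Perm α) :
    (symmetrizer k Kᶜ * antisymmetrizer k K).coeff σ = restrictSign k σ K := by
  rw [restrictSign, symmetrizer, antisymmetrizer]
  split_ifs with h
  · nth_rewrite 1 [← restrictPerm_compl_mul_restrictPerm h]
    rw [coeff_twistedSum_mul_twistedSum_of_disjoint _ _ (disjoint_permsOn disjoint_compl_left)
      (restrictPerm_mem_permsOn h.compl) (restrictPerm_mem_permsOn h), signHom_inv]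
    simp
  · refine coeff_twistedSum_mul_twistedSum_eq_zero _ _ fun r hr s hs hrs => h ?_
    rw [← hrs]
    exact isInvariant_mul_of_mem_permsOn hr hs

theorem restrictSign_conj (σ τ : Perm α) (B : Finset α) :
    restrictSign k (τ⁻¹ * σ * τ) B = restrictSign k σ (τ • B) := by
  by_cases h : IsInvariant σ (τ • B)
  · rw [restrictSign, restrictSign, if_pos h, if_pos ((isInvariant_conj_iff σ τ B).2 h),
      restrictPerm_conj h, map_mul, map_mul, mul_right_comm, ← map_mul, inv_mul_cancel, map_one,
      one_mul]
  · rw [restrictSign, restrictSign, if_neg h, if_neg (mt (isInvariant_conj_iff σ τ B).1 h)]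

theorem classAverage_symmetrizer_compl_mul_antisymmetrizer [IsDomain k] [CharZero k]
    (K : Finset α) (σ : Perm α) :
    classAverage σ (symmetrizer k Kᶜ * antisymmetrizer k K)
      = (K.card.factorial * Kᶜ.card.factorial : k) *
        ∑ B ∈ Finset.powersetCard K.card Finset.univ, restrictSign k σ B := by
  have := Set.powersetCard.isPretransitive (α := α) (n := K.card)
  have hcard : Fintype.card (Set.powersetCard α K.card) = (Fintype.card α).choose K.card := by
    rw [← Nat.card_eq_fintype_card, Set.powersetCard.card, Nat.card_eq_fintype_card]
  have hsum : ∑ B : Set.powersetCard α K.card, restrictSign k σ B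
      = ∑ B ∈ Finset.powersetCard K.card Finset.univ, restrictSign k σ B :=
    (Finset.sum_subtype _ (by simp [Set.powersetCard.mem_iff]) _).symm
  have haverage := card_nsmul_sum_smul_eq (G := Perm α)
    (fun B : Set.powersetCard α K.card => restrictSign k σ B) (Set.powersetCard.ofCard rfl)
  simp only [hcard, hsum, Fintype.card_perm, nsmul_eq_mul] at haverage
  have hchoose : ((Fintype.card α).choose K.card : k) ≠ 0 :=
    Nat.cast_ne_zero.2 (Nat.choose_pos (Finset.card_le_univ K)).ne'
  refine mul_left_cancel₀ hchoose ?_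
  rw [classAverage_apply]
  simp only [coeff_symmetrizer_compl_mul_antisymmetrizer, restrictSign_conj]
  refine haverage.trans ?_
  rw [← Nat.choose_mul_factorial_mul_factorial (Finset.card_le_univ K), Finset.card_compl]
  push_cast
  ring

end Invariant

/-! ### The signed generating function of invariant sets -/

section Orbits

open Polynomial

variable {α : Type*} [DecidableEq α] [Fintype α] {σ : Perm α}

open Classical in
/-- The partition of the ground set into the orbits of a permutation, fixed points included. -/
def orbits (σ : Perm α) : Finpartition (Finset.univ : Finset α) :=
  Finpartition.ofSetoid (Perm.SameCycle.setoid σ)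

theorem mem_part_orbits {a b : α} : b ∈ (orbits σ).part a ↔ σ.SameCycle a b := by
  classical
  exact Finpartition.mem_part_ofSetoid_iff_rel

theorem isInvariant_part_orbits (σ : Perm α) (a : α) : IsInvariant σ ((orbits σ).part a) :=
  fun b => by rw [mem_part_orbits, mem_part_orbits, Perm.sameCycle_apply_right]

theorem exists_part_orbits_eq {o : Finset α} (ho : o ∈ (orbits σ).parts) :
    ∃ a, (orbits σ).part a = o := by
  obtain ⟨a, ha⟩ := (orbits σ).nonempty_of_mem_parts ho
  exact ⟨a, (orbits σ).part_eq_of_mem ho ha⟩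

theorem part_orbits_subset {B : Finset α} (h : IsInvariant σ B) {a : α} (ha : a ∈ B) :
    (orbits σ).part a ⊆ B := by
  intro b hb
  obtain ⟨i, rfl⟩ := (mem_part_orbits.1 hb).exists_nat_pow_eq
  clear hb
  induction i with
  | zero => exact ha
  | succ i ih => rwa [pow_succ', Perm.mul_apply, h]

theorem part_orbits_of_fixed {a : α} (ha : σ a = a) : (orbits σ).part a = {a} := by
  refine (part_orbits_subset (fun b => ?_) (Finset.mem_singleton_self a)).antisymm
    (Finset.singleton_subset_iff.2 (mem_part_orbits.2 (.refl σ a)))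
  rw [Finset.mem_singleton, Finset.mem_singleton]
  nth_rewrite 1 [← ha]
  exact σ.injective.eq_iff

theorem part_orbits_of_not_fixed {a : α} (ha : σ a ≠ a) :
    (orbits σ).part a = (σ.cycleOf a).support := by
  ext b
  rw [mem_part_orbits, Perm.mem_support_cycleOf_iff' ha]

theorem parts_orbits (σ : Perm α) :
    (orbits σ).parts = σ.cycleFactorsFinset.image Perm.support ∪
      σ.supportᶜ.map ⟨fun a => {a}, Finset.singleton_injective⟩ := by
  ext o
  simp only [Finset.mem_union, Finset.mem_image, Finset.mem_map, Finset.mem_compl,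
    Perm.mem_support, not_not, Function.Embedding.coeFn_mk]
  constructor
  · intro ho
    obtain ⟨a, rfl⟩ := exists_part_orbits_eq ho
    by_cases ha : σ a = a
    · exact Or.inr ⟨a, ha, (part_orbits_of_fixed ha).symm⟩
    · exact Or.inl ⟨σ.cycleOf a, Perm.cycleOf_mem_cycleFactorsFinset_iff.2
        (Perm.mem_support.2 ha), (part_orbits_of_not_fixed ha).symm⟩
  · rintro (⟨c, hc, rfl⟩ | ⟨a, ha, rfl⟩)
    · obtain ⟨a, ha⟩ := (Perm.mem_cycleFactorsFinset_iff.1 hc).1.nonempty_support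
      have hσa := Perm.mem_support.1 (Perm.mem_cycleFactorsFinset_support_le hc ha)
      rw [Perm.cycle_is_cycleOf ha hc, ← part_orbits_of_not_fixed hσa]
      exact (orbits σ).part_mem.2 (Finset.mem_univ a)
    · rw [← part_orbits_of_fixed ha]
      exact (orbits σ).part_mem.2 (Finset.mem_univ a)

theorem support_injOn_cycleFactorsFinset (σ : Perm α) :
    Set.InjOn Perm.support (σ.cycleFactorsFinset : Set (Perm α)) := by
  intro c hc c' hc' h
  obtain ⟨a, ha⟩ := (Perm.mem_cycleFactorsFinset_iff.1 hc).1.nonempty_support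
  rw [Perm.cycle_is_cycleOf ha hc, Perm.cycle_is_cycleOf (h ▸ ha) hc']

theorem prod_card_parts_orbits {M : Type*} [CommMonoid M] (σ : Perm α) (f : ℕ → M) :
    ∏ o ∈ (orbits σ).parts, f o.card = (σ.partition.parts.map f).prod := by
  have hdisj : Disjoint (σ.cycleFactorsFinset.image Perm.support)
      (σ.supportᶜ.map ⟨fun a => {a}, Finset.singleton_injective⟩) := by
    rw [Finset.disjoint_left]
    intro o ho ho'
    obtain ⟨c, hc, rfl⟩ := Finset.mem_image.1 ho
    obtain ⟨a, -, ha⟩ := Finset.mem_map.1 ho'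
    have hc' := (Perm.mem_cycleFactorsFinset_iff.1 hc).1.two_le_card_support
    rw [← ha, Function.Embedding.coeFn_mk, Finset.card_singleton] at hc'
    omega
  rw [parts_orbits, Finset.prod_union hdisj,
    Finset.prod_image (support_injOn_cycleFactorsFinset σ), Finset.prod_map, Perm.parts_partition,
    Multiset.map_add, Multiset.prod_add, Perm.cycleType_def, Multiset.map_map,
    Multiset.map_replicate, Multiset.prod_replicate, ← Finset.card_compl]
  simp [Finset.prod_const]

theorem isInvariant_biUnion_orbits {T : Finset (Finset α)} (hT : T ⊆ (orbits σ).parts) :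
    IsInvariant σ (T.biUnion id) := by
  intro a
  simp only [Finset.mem_biUnion, id]
  refine exists_congr fun o => and_congr_right fun ho => ?_
  obtain ⟨b, rfl⟩ := exists_part_orbits_eq (hT ho)
  exact isInvariant_part_orbits σ b a

open Classical in
theorem sum_isInvariant {M : Type*} [AddCommMonoid M] (σ : Perm α) (f : Finset α → M) :
    ∑ B with IsInvariant σ B, f B = ∑ T ∈ (orbits σ).parts.powerset, f (T.biUnion id) := by
  symm
  refine Finset.sum_bij' (fun T _ => T.biUnion id) (fun B _ => {o ∈ (orbits σ).parts | o ⊆ B})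
    (fun T hT => ?_) (fun B _ => ?_) (fun T hT => ?_) (fun B hB => ?_) fun _ _ => rfl
  · simpa using isInvariant_biUnion_orbits (Finset.mem_powerset.1 hT)
  · simp
  · rw [Finset.mem_powerset] at hT
    ext o
    rw [Finset.mem_filter]
    refine ⟨fun ⟨ho, hsub⟩ => ?_, fun ho => ⟨hT ho, Finset.subset_biUnion_of_mem id ho⟩⟩
    obtain ⟨a, ha⟩ := (orbits σ).nonempty_of_mem_parts ho
    obtain ⟨o', ho', ha'⟩ := Finset.mem_biUnion.1 (hsub ha)
    rwa [(orbits σ).eq_of_mem_parts ho (hT ho') ha ha']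
  · have hB' : IsInvariant σ B := by simpa using hB
    refine (Finset.biUnion_subset.2 fun o ho => (Finset.mem_filter.1 ho).2).antisymm fun a ha => ?_
    exact Finset.mem_biUnion.2 ⟨(orbits σ).part a, Finset.mem_filter.2
      ⟨(orbits σ).part_mem.2 (Finset.mem_univ a), part_orbits_subset hB' ha⟩,
      mem_part_orbits.2 (.refl σ a)⟩

variable (k : Type*) [CommRing k]

/-- The contribution `sgn(σ|B) (-X)^|B|` of a set to the signed generating function of the
invariant sets, zero if the set is not invariant. -/
def invariantTerm (σ : Perm α) (B : Finset α) : k[X] :=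
  C (restrictSign k σ B) * (-X) ^ B.card

theorem invariantTerm_empty (σ : Perm α) : invariantTerm k σ ∅ = 1 := by
  have hempty : IsInvariant σ ∅ := by simp [IsInvariant]
  have hone : restrictPerm σ ∅ = 1 := Perm.ext fun a => by simp [restrictPerm_apply hempty]
  simp [invariantTerm, restrictSign, hempty, hone]

theorem invariantTerm_union {B B' : Finset α} (h : IsInvariant σ B) (h' : IsInvariant σ B')
    (hdisj : Disjoint B B') :
    invariantTerm k σ (B ∪ B') = invariantTerm k σ B * invariantTerm k σ B' := by
  rw [invariantTerm, invariantTerm, invariantTerm, restrictSign, restrictSign, restrictSign,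
    if_pos h, if_pos h', if_pos (h.union h'), restrictPerm_union h h' hdisj, map_mul, C_mul,
    Finset.card_union_of_disjoint hdisj, pow_add, mul_mul_mul_comm]

theorem invariantTerm_part_orbits (σ : Perm α) (a : α) :
    invariantTerm k σ ((orbits σ).part a) = -X ^ ((orbits σ).part a).card := by
  have hrestrict : restrictPerm σ ((orbits σ).part a) = σ.cycleOf a := by
    ext b
    rw [restrictPerm_apply (isInvariant_part_orbits σ a), Perm.cycleOf_apply]
    simp only [mem_part_orbits]
  rw [invariantTerm, restrictSign, if_pos (isInvariant_part_orbits σ a), hrestrict]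
  by_cases ha : σ a = a
  · simp [part_orbits_of_fixed ha, (Perm.cycleOf_eq_one_iff σ).2 ha]
  · rw [part_orbits_of_not_fixed ha, signHom_of_isCycle k (Perm.isCycle_cycleOf σ ha),
      neg_pow (X : k[X]), ← mul_assoc]
    simp [← mul_pow]

theorem invariantTerm_biUnion_orbits {T : Finset (Finset α)} (hT : T ⊆ (orbits σ).parts) :
    invariantTerm k σ (T.biUnion id) = ∏ o ∈ T, -X ^ o.card := by
  induction T using Finset.induction_on with
  | empty => exact invariantTerm_empty k σ
  | insert o T ho ih =>
    obtain ⟨ho', hT'⟩ := Finset.insert_subset_iff.1 hT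
    have hdisj : Disjoint o (T.biUnion id) := by
      rw [Finset.disjoint_biUnion_right]
      exact fun o' h' => (orbits σ).disjoint ho' (hT' h') (ne_of_mem_of_not_mem h' ho).symm
    obtain ⟨a, rfl⟩ := exists_part_orbits_eq ho'
    rw [Finset.prod_insert ho, Finset.biUnion_insert, id, invariantTerm_union k
      (isInvariant_part_orbits σ a) (isInvariant_biUnion_orbits hT') hdisj, ih hT',
      invariantTerm_part_orbits]

theorem sum_invariantTerm (σ : Perm α) :
    ∑ B, invariantTerm k σ B = (σ.partition.parts.map fun m => 1 - (X : k[X]) ^ m).prod := by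
  classical
  have hzero : ∀ B ∈ Finset.univ, invariantTerm k σ B ≠ 0 → IsInvariant σ B := by
    intro B _ hne
    by_contra h
    exact hne (by rw [invariantTerm, restrictSign, if_neg h, C_0, zero_mul])
  calc ∑ B, invariantTerm k σ B
      = ∑ T ∈ (orbits σ).parts.powerset, ∏ o ∈ T, -X ^ o.card := by
        rw [← Finset.sum_filter_of_ne hzero, sum_isInvariant]
        exact Finset.sum_congr rfl fun T hT =>
          invariantTerm_biUnion_orbits k (Finset.mem_powerset.1 hT)
    _ = ∏ o ∈ (orbits σ).parts, (1 - X ^ o.card) := by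
        simp only [sub_eq_add_neg, Finset.prod_one_add]
    _ = _ := prod_card_parts_orbits σ fun m => 1 - X ^ m

theorem coeff_prod_one_sub_X_pow (σ : Perm α) (n : ℕ) :
    ((σ.partition.parts.map fun m => 1 - (X : k[X]) ^ m).prod).coeff n
      = (-1) ^ n * ∑ B ∈ Finset.powersetCard n Finset.univ, restrictSign k σ B := by
  have hcoeff : ∀ B : Finset α, (invariantTerm k σ B).coeff n
      = if B.card = n then (-1) ^ n * restrictSign k σ B else 0 := by
    intro B
    have hpow : invariantTerm k σ B = C ((-1) ^ B.card * restrictSign k σ B) * X ^ B.card := by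
      rw [invariantTerm, neg_pow, C_mul, C_pow, C_neg, C_1]
      ring
    rw [hpow, coeff_C_mul_X_pow]
    by_cases h : B.card = n
    · simp [h]
    · rw [if_neg (Ne.symm h), if_neg h]
  rw [← sum_invariantTerm, finsetSum_coeff, Finset.sum_congr rfl fun B _ => hcoeff B,
    ← Finset.sum_filter, ← Finset.mul_sum, Finset.powersetCard_eq_filter, Finset.powerset_univ]

end Orbits
/-! ### The characters of hooks -/

section HookPoly

open Polynomial

variable (k : Type*) [Field k]

/-- The generating polynomial `∏ (1 - X ^ m) / (1 - X)` of the hook characters at a permutation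
whose cycle lengths, fixed points included, form the given multiset. -/
def hookPoly (s : Multiset ℕ) : k[X] :=
  (s.map fun m => 1 - (X : k[X]) ^ m).prod / (1 - X)

theorem hookPoly_cons (m : ℕ) (t : Multiset ℕ) :
    hookPoly k (m ::ₘ t) =
      (∑ i ∈ Finset.range m, X ^ i) * (t.map fun m => 1 - (X : k[X]) ^ m).prod := by
  have hX : (1 - X : k[X]) ≠ 0 := fun h => by simpa using congrArg (eval 0) h
  rw [hookPoly, Multiset.map_cons, Multiset.prod_cons, ← mul_neg_geom_sum (X : k[X]) m, mul_assoc,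
    mul_div_cancel_left₀ _ hX]

theorem hookPoly_singleton (m : ℕ) : hookPoly k {m} = ∑ i ∈ Finset.range m, X ^ i := by
  rw [← Multiset.cons_zero, hookPoly_cons, Multiset.map_zero, Multiset.prod_zero, mul_one]

theorem one_sub_X_mul_hookPoly {s : Multiset ℕ} (hs : s ≠ 0) :
    (1 - X) * hookPoly k s = (s.map fun m => 1 - (X : k[X]) ^ m).prod := by
  obtain ⟨m, hm⟩ := Multiset.exists_mem_of_ne_zero hs
  obtain ⟨t, rfl⟩ := Multiset.exists_cons_of_mem hm
  rw [hookPoly_cons, ← mul_assoc, mul_neg_geom_sum, Multiset.map_cons, Multiset.prod_cons]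

theorem natDegree_prod_one_sub_X_pow_le (t : Multiset ℕ) :
    ((t.map fun m => 1 - (X : k[X]) ^ m).prod).natDegree ≤ t.sum := by
  induction t using Multiset.induction_on with
  | empty => simp
  | cons m t ih =>
    rw [Multiset.map_cons, Multiset.prod_cons, Multiset.sum_cons]
    refine natDegree_mul_le.trans (add_le_add ((natDegree_sub_le _ _).trans ?_) ih)
    simp

theorem natDegree_hookPoly_lt {s : Multiset ℕ} (hs : s ≠ 0) (hpos : ∀ m ∈ s, 0 < m) :
    (hookPoly k s).natDegree < s.sum := by
  obtain ⟨m, hm⟩ := Multiset.exists_mem_of_ne_zero hs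
  obtain ⟨t, rfl⟩ := Multiset.exists_cons_of_mem hm
  have hgeom : (∑ i ∈ Finset.range m, (X : k[X]) ^ i).natDegree ≤ m - 1 :=
    natDegree_sum_le_of_forall_le _ _ fun i hi => by
      rw [natDegree_X_pow]
      exact Nat.le_sub_one_of_lt (Finset.mem_range.1 hi)
  have hdeg := natDegree_mul_le.trans (add_le_add hgeom (natDegree_prod_one_sub_X_pow_le k t))
  have hm' := hpos m (Multiset.mem_cons_self m t)
  rw [hookPoly_cons, Multiset.sum_cons]
  omega

theorem eval_one_hookPoly_singleton (m : ℕ) : (hookPoly k {m}).eval 1 = m := by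
  simp [hookPoly_singleton, eval_finsetSum]

theorem eval_one_hookPoly_eq_zero {s : Multiset ℕ} (hs : 1 < Multiset.card s) :
    (hookPoly k s).eval 1 = 0 := by
  obtain ⟨m, hm⟩ := Multiset.card_pos_iff_exists_mem.1 (one_pos.trans hs)
  obtain ⟨t, rfl⟩ := Multiset.exists_cons_of_mem hm
  rw [Multiset.card_cons, Nat.lt_add_left_iff_pos] at hs
  obtain ⟨m', hm'⟩ := Multiset.card_pos_iff_exists_mem.1 hs
  obtain ⟨u, rfl⟩ := Multiset.exists_cons_of_mem hm'
  simp [hookPoly_cons]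

theorem coeff_hookPoly_singleton {d i : ℕ} (hi : i < d) : (hookPoly k {d}).coeff i = 1 := by
  simp [hookPoly_singleton, finsetSum_coeff, coeff_X_pow, hi]

end HookPoly

section HookCharacter

open Polynomial

variable {α : Type*} [DecidableEq α] [Fintype α]

theorem parts_partition_ne_zero [Nonempty α] (σ : Perm α) : σ.partition.parts ≠ 0 := by
  intro h
  have hsum := σ.partition.parts_sum
  rw [h, Multiset.sum_zero] at hsum
  exact Fintype.card_ne_zero hsum.symm

theorem parts_partition_inv (σ : Perm α) : σ⁻¹.partition.parts = σ.partition.parts := by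
  rw [Perm.parts_partition, Perm.parts_partition, Perm.cycleType_inv, Perm.support_inv]

variable (k : Type*) [Field k]

theorem eval_one_hookPoly_partition_eq_zero {τ : Perm α} [Nonempty α]
    (hτ : τ.partition.parts ≠ {Fintype.card α}) :
    (hookPoly k τ.partition.parts).eval 1 = 0 := by
  refine eval_one_hookPoly_eq_zero k ?_
  by_contra! hcard
  obtain ⟨m, hm⟩ := Multiset.card_eq_one.1
    (hcard.antisymm (Multiset.card_pos.2 (parts_partition_ne_zero τ)))
  have hsum := τ.partition.parts_sum
  rw [hm, Multiset.sum_singleton] at hsum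
  exact hτ (hsum ▸ hm)

/-- The product of the hook lengths of the hook-shaped Young diagram whose first column is a corner
cell followed by the cells `K`, the remaining cells of the ground set forming the first row. -/
def hookLengthProd (K : Finset α) : k :=
  K.card.factorial * (Kᶜ.card - 1).factorial * Fintype.card α

variable [CharZero k]

theorem hookLengthProd_ne_zero [Nonempty α] (K : Finset α) : hookLengthProd k K ≠ 0 :=
  mul_ne_zero (mul_ne_zero (Nat.cast_ne_zero.2 (Nat.factorial_ne_zero _))
    (Nat.cast_ne_zero.2 (Nat.factorial_ne_zero _))) (Nat.cast_ne_zero.2 Fintype.card_ne_zero)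

theorem hookSymmetrizer_compl_mul_self {K : Finset α} {x : α} (hx : x ∉ K) :
    hookSymmetrizer k Kᶜ K x * hookSymmetrizer k Kᶜ K x
      = hookLengthProd k K • hookSymmetrizer k Kᶜ K x := by
  rw [hookSymmetrizer_mul_self k disjoint_compl_left (Finset.mem_compl.2 hx), ← Nat.cast_add,
    Finset.card_compl_add_card, hookLengthProd]

theorem classAverage_symmetrizer_compl_mul_antisymmetrizer_eq_coeff [Nonempty α] (σ : Perm α)
    (K : Finset α) :
    classAverage σ (symmetrizer k Kᶜ * antisymmetrizer k K)
      = (K.card.factorial * Kᶜ.card.factorial : k) *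
        ((-1) ^ K.card * ((1 - X) * hookPoly k σ.partition.parts).coeff K.card) := by
  rw [classAverage_symmetrizer_compl_mul_antisymmetrizer,
    one_sub_X_mul_hookPoly k (parts_partition_ne_zero σ), coeff_prod_one_sub_X_pow,
    ← mul_assoc ((-1 : k) ^ K.card), ← mul_pow, neg_one_mul, neg_neg, one_pow, one_mul]

theorem classAverage_hookSymmetrizer_compl (σ : Perm α) {K : Finset α} {x : α} (hx : x ∉ K) :
    classAverage σ (hookSymmetrizer k Kᶜ K x)
      = hookLengthProd k K * ((-1) ^ K.card * (hookPoly k σ.partition.parts).coeff K.card) := by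
  have : Nonempty α := ⟨x⟩
  have hfactorial : ∀ {B : Finset α} {y : α}, y ∉ B →
      (Bᶜ.card.factorial : k) = Bᶜ.card * (Bᶜ.card - 1).factorial := fun hy => by
    exact_mod_cast (Nat.mul_factorial_pred
      (Finset.card_ne_zero_of_mem (Finset.mem_compl.2 hy))).symm
  induction hj : K.card generalizing K x with
  | zero =>
    obtain rfl := Finset.card_eq_zero.1 hj
    have hempty : hookSymmetrizer k ∅ᶜ ∅ x = symmetrizer k ∅ᶜ * antisymmetrizer k ∅ := by
      rw [hookSymmetrizer, antisymmetrizer_insert k hx, starSum, Finset.sum_empty, sub_zero,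
        mul_one]
    rw [hempty, classAverage_symmetrizer_compl_mul_antisymmetrizer_eq_coeff, hfactorial hx,
      hookLengthProd]
    simp only [Finset.card_empty, Finset.compl_empty, Finset.card_univ, mul_coeff_zero,
      Polynomial.coeff_sub, coeff_one_zero, coeff_X_zero]
    ring
  | succ j ih =>
    obtain ⟨z, hz⟩ : K.Nonempty := Finset.card_pos.1 (hj ▸ j.succ_pos)
    have hcompl : insert z Kᶜ = (K.erase z)ᶜ := Finset.compl_erase.symm
    have hcard : (K.erase z)ᶜ.card - 1 = Kᶜ.card := by
      rw [← hcompl, Finset.card_insert_of_notMem (Finset.notMem_compl.2 hz), Nat.add_sub_cancel]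
    have hcardErase : (K.erase z).card = j := by
      rw [Finset.card_erase_of_mem hz, hj, Nat.add_sub_cancel]
    have hrec := classAverage_hookSymmetrizer_recursion k disjoint_compl_left
      (Finset.mem_compl.2 hx) hz σ
    rw [hcompl, ih (Finset.notMem_erase z K) hcardErase, hookLengthProd, hcard, hcardErase,
      classAverage_symmetrizer_compl_mul_antisymmetrizer_eq_coeff, ← Nat.cast_add,
      Finset.card_compl_add_card, hj, hfactorial hx, sub_mul, one_mul, Polynomial.coeff_sub,
      coeff_X_mul, Nat.factorial_succ] at hrec
    have hne : (Kᶜ.card : k) ≠ 0 :=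
      Nat.cast_ne_zero.2 (Finset.card_ne_zero_of_mem (Finset.mem_compl.2 hx))
    refine mul_left_cancel₀ hne ?_
    rw [hookLengthProd, hj, Nat.factorial_succ]
    push_cast at hrec ⊢
    linear_combination hrec

theorem character_hookSymmetrizer_compl (σ : Perm α) {K : Finset α} {x : α} (hx : x ∉ K) :
    (leftIdealRep (hookSymmetrizer k Kᶜ K x)).character σ
      = (-1) ^ K.card * (hookPoly k σ.partition.parts).coeff K.card := by
  have : Nonempty α := ⟨x⟩
  rw [character_leftIdealRep (hookLengthProd_ne_zero k K) (hookSymmetrizer_compl_mul_self k hx),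
    classAverage_hookSymmetrizer_compl k _ hx, parts_partition_inv,
    mul_div_cancel_left₀ _ (hookLengthProd_ne_zero k K)]

end HookCharacter

/-! ### Vanishing of non-hook characters on long cycles -/

section Vanishing

open Polynomial

variable {α ι κ : Type*}

/-- The permutations preserving the fibres of a labelling of the points. -/
def fiberPerms (f : α → ι) : Subgroup (Perm α) where
  carrier := {σ | ∀ a, f (σ a) = f a}
  one_mem' _ := rfl
  mul_mem' hσ hτ a := (hσ _).trans (hτ a)
  inv_mem' {σ} hσ a := by rw [← hσ (σ⁻¹ a), Perm.inv_def, apply_symm_apply]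

theorem swap_mem_fiberPerms [DecidableEq α] {f : α → ι} {x y : α} (h : f x = f y) :
    swap x y ∈ fiberPerms f := by
  intro a
  rw [swap_apply_def]
  split_ifs with hx hy
  · rw [hx, h]
  · rw [hy, h]
  · rfl

theorem exists_finset_card_eq_notMem [Fintype α] {i : ℕ} (hi : i < Fintype.card α) :
    ∃ (K : Finset α) (x : α), K.card = i ∧ x ∉ K := by
  obtain ⟨K, -, hK⟩ := Finset.exists_subset_card_eq (s := (Finset.univ : Finset α)) hi.le
  obtain ⟨x, hx⟩ : ∃ x, x ∉ K := by
    by_contra! h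
    rw [Finset.eq_univ_iff_forall.2 h, Finset.card_univ] at hK
    exact hi.ne' hK
  exact ⟨K, x, hK, hx⟩

variable [DecidableEq α] [Fintype α]

theorem exists_swap_mem_permsOn_mem_fiberPerms [DecidableEq ι] {f : α → ι} {S : Finset α}
    (hS : (Finset.univ.image f).card < S.card) (τ : Perm α) :
    ∃ y z, y ≠ z ∧ swap y z ∈ permsOn S ∧ τ⁻¹ * swap y z * τ ∈ fiberPerms f := by
  obtain ⟨y, hy, z, hz, hne, hyz⟩ := Finset.exists_ne_map_eq_of_card_lt_of_maps_to hS
    (f := fun a => f (τ⁻¹ a)) fun a _ => Finset.mem_image_of_mem f (Finset.mem_univ _)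
  refine ⟨y, z, hne, swap_mem_permsOn hy hz, ?_⟩
  have hconj : τ⁻¹ * swap y z * τ = swap (τ⁻¹ y) (τ⁻¹ z) := by
    rw [swap_apply_apply, inv_inv]
  rw [hconj]
  exact swap_mem_fiberPerms hyz

theorem twistedSum_permsOn_mul_of_mul_twistedSum_fiberPerms_eq_zero {k : Type*} [CommRing k]
    [IsDomain k] [DecidableEq ι] {χ ψ : Perm α →* k}
    (hχψ : ∀ y z, y ≠ z → χ (swap y z) ≠ ψ (swap y z)) {f : α → ι} {S : Finset α}
    (hS : (Finset.univ.image f).card < S.card) (τ : Perm α) :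
    twistedSum χ (permsOn S) * of k (Perm α) τ * twistedSum ψ (fiberPerms f) = 0 := by
  obtain ⟨y, z, hne, hy, hz⟩ := exists_swap_mem_permsOn_mem_fiberPerms hS τ
  exact twistedSum_mul_of_mul_twistedSum_eq_zero hy hz (hχψ y z hne)

variable (k : Type*)

/-- The product of the symmetrizer preserving the labels `r` and the antisymmetrizer preserving the
labels `c`. It is a Young symmetrizer when these are the row and column indices of cells. -/
def labelSymmetrizer [CommRing k] (r : α → ι) (c : α → κ) : MonoidAlgebra k (Perm α) :=
  twistedSum 1 (fiberPerms r) * twistedSum (signHom k) (fiberPerms c)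

variable [Field k] [CharZero k] [DecidableEq ι] [DecidableEq κ] {r : α → ι} {c : α → κ}

/-- A hook has either more rows than `r` has labels or more columns than `c` has labels, so two
points of its first column share an `r`-label or two points of its first row share a `c`-label. -/
theorem conjSum_hookSymmetrizer_mul_labelSymmetrizer
    (hrc : (Finset.univ.image r).card + (Finset.univ.image c).card ≤ Fintype.card α)
    {K : Finset α} {x : α} (hx : x ∉ K) :
    conjSum (hookSymmetrizer k Kᶜ K x) * labelSymmetrizer k r c = 0 := by
  have hsign : ∀ y z : α, y ≠ z → signHom k (swap y z) ≠ (1 : Perm α →* k) (swap y z) := by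
    intro y z hyz
    rw [signHom_swap k hyz, MonoidHom.one_apply]
    exact (self_ne_neg.2 one_ne_zero).symm
  have hcard := Finset.card_compl_add_card K
  rw [labelSymmetrizer]
  rcases Nat.lt_or_ge (Finset.univ.image r).card (K.card + 1) with h | h
  · rw [← Finset.card_insert_of_notMem hx] at h
    have hzero := twistedSum_permsOn_mul_of_mul_twistedSum_fiberPerms_eq_zero hsign h
    rw [conjSum, Finset.sum_mul]
    refine Finset.sum_eq_zero fun τ _ => ?_
    calc of k (Perm α) τ * hookSymmetrizer k Kᶜ K x * of k (Perm α) τ⁻¹ *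
          (twistedSum 1 (fiberPerms r) * twistedSum (signHom k) (fiberPerms c))
        = of k (Perm α) τ * symmetrizer k Kᶜ * (twistedSum (signHom k) (permsOn (insert x K)) *
            of k (Perm α) τ⁻¹ * twistedSum 1 (fiberPerms r)) *
            twistedSum (signHom k) (fiberPerms c) := by
          simp only [hookSymmetrizer, antisymmetrizer, mul_assoc]
      _ = 0 := by rw [hzero, mul_zero, zero_mul]
  · have h' : (Finset.univ.image c).card < Kᶜ.card := by omega
    have hzero := twistedSum_permsOn_mul_of_mul_twistedSum_fiberPerms_eq_zero
      (fun y z hyz => (hsign y z hyz).symm) h'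
    rw [hookSymmetrizer, conjSum_mul_comm, ← mul_assoc, (commute_conjSum _ _).eq, mul_assoc,
      conjSum, Finset.sum_mul, Finset.sum_eq_zero, mul_zero]
    intro τ _
    calc of k (Perm α) τ * (antisymmetrizer k (insert x K) * symmetrizer k Kᶜ) *
          of k (Perm α) τ⁻¹ * twistedSum (signHom k) (fiberPerms c)
        = of k (Perm α) τ * antisymmetrizer k (insert x K) * (twistedSum 1 (permsOn Kᶜ) *
            of k (Perm α) τ⁻¹ * twistedSum (signHom k) (fiberPerms c)) := by
          simp only [symmetrizer, mul_assoc]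
      _ = 0 := by rw [hzero, mul_zero]

theorem sum_coeff_hookPoly_mul_character_eq_zero
    (hrc : (Finset.univ.image r).card + (Finset.univ.image c).card ≤ Fintype.card α) {i : ℕ}
    (hi : i < Fintype.card α) :
    ∑ σ : Perm α, (hookPoly k σ.partition.parts).coeff i *
      (leftIdealRep (labelSymmetrizer k r c)).character σ = 0 := by
  obtain ⟨K, x, rfl, hx⟩ := exists_finset_card_eq_notMem hi
  have : Nonempty α := ⟨x⟩
  have hsum := sum_coeff_mul_character_leftIdealRep_eq_zero (commute_conjSum _)
    (conjSum_hookSymmetrizer_mul_labelSymmetrizer k hrc hx)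
  simp only [coeff_conjSum, classAverage_hookSymmetrizer_compl k _ hx, mul_assoc,
    ← Finset.mul_sum] at hsum
  rw [mul_eq_zero, mul_eq_zero] at hsum
  exact (hsum.resolve_left (hookLengthProd_ne_zero k K)).resolve_left
    (pow_ne_zero _ (neg_ne_zero.2 one_ne_zero))

theorem sum_eval_one_hookPoly_mul_character_eq_zero [Nonempty α]
    (hrc : (Finset.univ.image r).card + (Finset.univ.image c).card ≤ Fintype.card α) :
    ∑ σ : Perm α, (hookPoly k σ.partition.parts).eval 1 *
      (leftIdealRep (labelSymmetrizer k r c)).character σ = 0 := by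
  have heval : ∀ σ : Perm α, (hookPoly k σ.partition.parts).eval 1
      = ∑ i ∈ Finset.range (Fintype.card α), (hookPoly k σ.partition.parts).coeff i := by
    intro σ
    have hdeg := natDegree_hookPoly_lt k (parts_partition_ne_zero σ)
      fun m hm => σ.partition.parts_pos hm
    rw [σ.partition.parts_sum] at hdeg
    simp [eval_eq_sum_range' hdeg]
  simp only [heval, Finset.sum_mul]
  rw [Finset.sum_comm]
  exact Finset.sum_eq_zero fun i hi =>
    sum_coeff_hookPoly_mul_character_eq_zero k hrc (Finset.mem_range.1 hi)

/-- The polynomial of hook characters takes the value `|α|` at `1` on long cycles and `0` on all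
other permutations, so the vanishing sum is a multiple of the character value on long cycles. -/
theorem character_labelSymmetrizer_eq_zero [Nonempty α]
    (hrc : (Finset.univ.image r).card + (Finset.univ.image c).card ≤ Fintype.card α)
    {σ : Perm α} (hσ : σ.partition.parts = {Fintype.card α}) :
    (leftIdealRep (labelSymmetrizer k r c)).character σ = 0 := by
  set V := leftIdealRep (labelSymmetrizer k r c)
  have hterm : ∀ τ : Perm α, (hookPoly k τ.partition.parts).eval 1 * V.character τ
      = if τ.partition.parts = {Fintype.card α} then Fintype.card α * V.character σ else 0 := by
    intro τ
    split_ifs with hτ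
    · obtain ⟨π, hπ⟩ := isConj_iff.1
        (Perm.partition_eq_of_isConj.2 (Nat.Partition.ext (hσ.trans hτ.symm)))
      rw [hτ, eval_one_hookPoly_singleton, ← hπ, Representation.char_conj]
    · rw [eval_one_hookPoly_partition_eq_zero k hτ, zero_mul]
  have hsum := sum_eval_one_hookPoly_mul_character_eq_zero k hrc
  simp only [V, hterm] at hsum
  rw [← Finset.sum_filter, Finset.sum_const, smul_eq_zero, mul_eq_zero] at hsum
  have hne : (Finset.univ.filter fun τ : Perm α => τ.partition.parts = {Fintype.card α}).card ≠ 0 :=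
    Finset.card_ne_zero_of_mem (a := σ) (by simp [hσ])
  exact (hsum.resolve_left hne).resolve_left (Nat.cast_ne_zero.2 Fintype.card_ne_zero)

end Vanishing
/-! ### Hook partitions -/

section Diagrams

theorem rowLen_ofRowLens_eq_getD (w : List ℕ) (hw : w.SortedGE) (i : ℕ) :
    (YoungDiagram.ofRowLens w hw).rowLen i = w.getD i 0 := by
  refine eq_of_forall_lt_iff fun j => ?_
  rw [← YoungDiagram.mem_iff_lt_rowLen, YoungDiagram.mem_ofRowLens, List.getD_eq_getElem?_getD]
  by_cases h : i < w.length <;> simp [h]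

theorem rowLen_diagram {d : ℕ} (p : d.Partition) (i : ℕ) :
    (diagram p).rowLen i = (p.parts.sort (· ≥ ·)).getD i 0 :=
  rowLen_ofRowLens_eq_getD _ _ i

/-- The hook partition `(d - k, 1, …, 1)` with `k` parts beyond the first. -/
def hookPartition {d : ℕ} (k : Fin d) : d.Partition where
  parts := (d - k) ::ₘ Multiset.replicate k 1
  parts_pos := by
    intro i hi
    rcases Multiset.mem_cons.1 hi with rfl | hi
    · exact Nat.sub_pos_of_lt k.2
    · rw [Multiset.eq_of_mem_replicate hi]
      exact one_pos
  parts_sum := by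
    rw [Multiset.sum_cons, Multiset.sum_replicate, smul_eq_mul, mul_one, Nat.sub_add_cancel k.2.le]

theorem hookPartition_injective {d : ℕ} : Function.Injective (hookPartition (d := d)) := by
  intro k l h
  have hcard := congrArg (fun p : d.Partition => Multiset.card p.parts) h
  simp only [hookPartition, Multiset.card_cons, Multiset.card_replicate] at hcard
  exact Fin.ext (Nat.succ_injective hcard)

theorem sort_hookPartition {d : ℕ} (k : Fin d) :
    (hookPartition k).parts.sort (· ≥ ·) = (d - k) :: List.replicate k 1 := by
  have hone : ∀ b ∈ Multiset.replicate (k : ℕ) 1, d - k ≥ b := fun b hb => by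
    rw [Multiset.eq_of_mem_replicate hb]
    exact Nat.sub_pos_of_lt k.2
  rw [hookPartition, Multiset.sort_cons _ _ _ hone, ← Multiset.coe_replicate, Multiset.coe_sort,
    List.mergeSort_of_pairwise]
  simp

theorem rowLen_hookPartition_zero {d : ℕ} (k : Fin d) :
    (diagram (hookPartition k)).rowLen 0 = d - k := by
  rw [rowLen_diagram, sort_hookPartition, List.getD_cons_zero]

theorem rowLen_hookPartition_succ {d : ℕ} (k : Fin d) (i : ℕ) :
    (diagram (hookPartition k)).rowLen (i + 1) = if i < k then 1 else 0 := by
  rw [rowLen_diagram, sort_hookPartition, List.getD_cons_succ]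
  split_ifs with h
  · rw [List.getD_replicate _ h]
  · rw [List.getD_eq_default]
    simpa using h

theorem exists_parts_eq_cons_replicate_one {d : ℕ} (hd : d ≠ 0) {p : d.Partition}
    (hp : ((1, 1) : ℕ × ℕ) ∉ diagram p) :
    ∃ a k, p.parts = a ::ₘ Multiset.replicate k 1 := by
  rw [YoungDiagram.mem_iff_lt_rowLen, rowLen_diagram, not_lt] at hp
  have hsort := Multiset.sort_eq p.parts (· ≥ ·)
  have hsorted := p.parts.pairwise_sort (· ≥ ·)
  generalize p.parts.sort (· ≥ ·) = L at hp hsort hsorted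
  cases L with
  | nil =>
    have hsum := p.parts_sum
    rw [← hsort, Multiset.coe_nil, Multiset.sum_zero] at hsum
    exact absurd hsum.symm hd
  | cons a L =>
    refine ⟨a, L.length, ?_⟩
    rw [← hsort, ← Multiset.cons_coe, ← Multiset.coe_replicate]
    congr
    refine List.eq_replicate_of_mem fun b hb => le_antisymm ?_ (p.parts_pos (hsort ▸ by simp [hb]))
    cases L with
    | nil => exact absurd hb List.not_mem_nil
    | cons e L =>
      refine le_trans ?_ hp
      rcases List.mem_cons.1 hb with rfl | hb
      · rfl
      · exact List.rel_of_pairwise_cons (List.Pairwise.of_cons hsorted) hb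

theorem mem_range_hookPartition {d : ℕ} (hd : d ≠ 0) {p : d.Partition}
    (hp : ((1, 1) : ℕ × ℕ) ∉ diagram p) : p ∈ Set.range (hookPartition (d := d)) := by
  obtain ⟨a, k, hparts⟩ := exists_parts_eq_cons_replicate_one hd hp
  have ha : 0 < a := p.parts_pos (hparts ▸ Multiset.mem_cons_self _ _)
  have hsum := p.parts_sum
  rw [hparts, Multiset.sum_cons, Multiset.sum_replicate, smul_eq_mul, mul_one] at hsum
  subst hsum
  refine ⟨⟨k, by omega⟩, Nat.Partition.ext ?_⟩
  simp only [hparts, hookPartition, Nat.add_sub_cancel]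

end Diagrams

/-! ### Characters as characters of label symmetrizers -/

section Characters

theorem youngSymmetrizer_eq_labelSymmetrizer (Y : YoungDiagram) :
    youngSymmetrizer Y = labelSymmetrizer ℚ (fun c : Y.cells => c.1.1) fun c => c.1.2 := by
  classical
  rw [youngSymmetrizer, rowSymmetrizer, colAntisymmetrizer, labelSymmetrizer, twistedSum,
    twistedSum]
  congr 1
  · simp only [MonoidHom.one_apply, one_smul]
    exact Finset.sum_subtype _ (fun σ => Finset.mem_filter_univ σ) _
  · simp only [signHom_inv]
    exact Finset.sum_subtype _ (fun σ => Finset.mem_filter_univ σ) _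

theorem character_spechtRep {Y : YoungDiagram} {c : MonoidAlgebra ℚ (CellPerm Y)}
    (h : youngSymmetrizer Y = c) (σ : CellPerm Y) :
    (spechtRep Y).character σ = (leftIdealRep c).character σ := by
  subst h
  rfl

theorem card_image_row_le_colLen (Y : YoungDiagram) :
    (Finset.univ.image fun c : Y.cells => c.1.1).card ≤ Y.colLen 0 := by
  rw [← Finset.card_range (Y.colLen 0)]
  refine Finset.card_le_card fun i hi => ?_
  obtain ⟨⟨⟨i, j⟩, hc⟩, -, rfl⟩ := Finset.mem_image.1 hi
  rw [Finset.mem_range, ← YoungDiagram.mem_iff_lt_colLen]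
  exact Y.up_left_mem le_rfl (Nat.zero_le j) ((YoungDiagram.mem_cells _).1 hc)

theorem card_image_col_le_rowLen (Y : YoungDiagram) :
    (Finset.univ.image fun c : Y.cells => c.1.2).card ≤ Y.rowLen 0 := by
  rw [← Finset.card_range (Y.rowLen 0)]
  refine Finset.card_le_card fun j hj => ?_
  obtain ⟨⟨⟨i, j⟩, hc⟩, -, rfl⟩ := Finset.mem_image.1 hj
  rw [Finset.mem_range, ← YoungDiagram.mem_iff_lt_rowLen]
  exact Y.up_left_mem (Nat.zero_le i) le_rfl ((YoungDiagram.mem_cells _).1 hc)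

theorem colLen_add_rowLen_le_card {Y : YoungDiagram} (h : ((1, 1) : ℕ × ℕ) ∈ Y) :
    Y.colLen 0 + Y.rowLen 0 ≤ Y.cells.card := by
  have hinter : Y.col 0 ∩ Y.row 0 ⊆ {(0, 0)} := by
    rintro ⟨i, j⟩ hc
    rw [Finset.mem_inter, YoungDiagram.mem_col_iff, YoungDiagram.mem_row_iff] at hc
    rw [Finset.mem_singleton, Prod.mk.injEq]
    exact ⟨hc.2.2, hc.1.2⟩
  have hcorner : ((1, 1) : ℕ × ℕ) ∉ Y.col 0 ∪ Y.row 0 := by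
    simp [YoungDiagram.mem_col_iff, YoungDiagram.mem_row_iff]
  have hsubset : insert (1, 1) (Y.col 0 ∪ Y.row 0) ⊆ Y.cells :=
    Finset.insert_subset h (Finset.union_subset (Finset.filter_subset _ _)
      (Finset.filter_subset _ _))
  have hle := Finset.card_le_card hsubset
  have hinter_card := Finset.card_le_card hinter
  rw [Finset.card_insert_of_notMem hcorner] at hle
  rw [Finset.card_singleton] at hinter_card
  rw [YoungDiagram.colLen_eq_card, YoungDiagram.rowLen_eq_card,
    ← Finset.card_union_add_card_inter]
  omega

theorem chi_indiscrete_eq_zero {d : ℕ} {p : d.Partition} (hp : ((1, 1) : ℕ × ℕ) ∈ diagram p) :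
    chi p (Nat.Partition.indiscrete d) = 0 := by
  have : Nonempty (diagram p).cells := ⟨⟨(1, 1), (YoungDiagram.mem_cells _).2 hp⟩⟩
  have hcard := card_cells_diagram p
  have hd : d ≠ 0 := hcard ▸ Fintype.card_ne_zero
  rw [chi, character_spechtRep (youngSymmetrizer_eq_labelSymmetrizer _)]
  refine character_labelSymmetrizer_eq_zero ℚ ?_ ?_
  · exact (add_le_add (card_image_row_le_colLen _) (card_image_col_le_rowLen _)).trans
      ((colLen_add_rowLen_le_card hp).trans (Fintype.card_coe _).ge)
  · rw [(exists_perm_parts p (Nat.Partition.indiscrete d)).choose_spec, hcard,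
      Nat.Partition.indiscrete_parts hd]

end Characters

/-! ### Hook characters -/

section HookDiagram

theorem fiberPerms_eq_permsOn {α ι : Type*} {f : α → ι} {S : Finset α}
    (h : ∀ a b, f a = f b ↔ a = b ∨ a ∈ S ∧ b ∈ S) : fiberPerms f = permsOn S := by
  ext σ
  rw [mem_permsOn]
  constructor
  · intro hσ a ha
    exact ((h _ _).1 (hσ a)).resolve_right fun hS => ha hS.2
  · intro hσ a
    by_cases ha : a ∈ S
    · exact (h _ _).2 (Or.inr ⟨(apply_mem_iff_of_mem_permsOn (mem_permsOn.2 hσ) a).2 ha, ha⟩)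
    · rw [hσ a ha]

/-- The cells of a Young diagram below its first row. -/
def cellsBelow (Y : YoungDiagram) : Finset Y.cells :=
  Finset.univ.filter fun c => c.1.1 ≠ 0

theorem mem_cellsBelow {Y : YoungDiagram} {c : Y.cells} : c ∈ cellsBelow Y ↔ c.1.1 ≠ 0 :=
  Finset.mem_filter_univ c

theorem card_compl_cellsBelow (Y : YoungDiagram) : (cellsBelow Y)ᶜ.card = Y.rowLen 0 := by
  have hmap : (cellsBelow Y)ᶜ.map (Function.Embedding.subtype _) = Y.row 0 := by
    ext c
    simp [mem_cellsBelow, YoungDiagram.mem_row_iff, and_comm]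
  rw [← Finset.card_map (Function.Embedding.subtype _), hmap, ← YoungDiagram.rowLen_eq_card]

theorem row_eq_zero_or_col_eq_zero {Y : YoungDiagram} (hY : ((1, 1) : ℕ × ℕ) ∉ Y) (c : Y.cells) :
    c.1.1 = 0 ∨ c.1.2 = 0 := by
  by_contra! h
  exact hY (Y.up_left_mem (Nat.one_le_iff_ne_zero.2 h.1) (Nat.one_le_iff_ne_zero.2 h.2)
    ((YoungDiagram.mem_cells _).1 c.2))

theorem youngSymmetrizer_eq_hookSymmetrizer {Y : YoungDiagram} (hY : ((1, 1) : ℕ × ℕ) ∉ Y)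
    {x : Y.cells} (hx : x.1 = (0, 0)) :
    youngSymmetrizer Y = hookSymmetrizer ℚ (cellsBelow Y)ᶜ (cellsBelow Y) x := by
  have hext : ∀ a b : Y.cells, a = b ↔ a.1.1 = b.1.1 ∧ a.1.2 = b.1.2 := fun a b => by
    rw [Subtype.ext_iff, Prod.ext_iff]
  have hhook := row_eq_zero_or_col_eq_zero hY
  have hrows : (fiberPerms fun c : Y.cells => c.1.1) = permsOn (cellsBelow Y)ᶜ := by
    refine fiberPerms_eq_permsOn fun a b => ?_
    have ha := hhook a
    have hb := hhook b
    rw [hext, Finset.mem_compl, Finset.mem_compl, mem_cellsBelow, mem_cellsBelow]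
    omega
  have hcols : (fiberPerms fun c : Y.cells => c.1.2) = permsOn (insert x (cellsBelow Y)) := by
    refine fiberPerms_eq_permsOn fun a b => ?_
    have ha := hhook a
    have hb := hhook b
    rw [hext, Finset.mem_insert, Finset.mem_insert, hext a x, hext b x, hx, mem_cellsBelow,
      mem_cellsBelow]
    omega
  rw [youngSymmetrizer_eq_labelSymmetrizer, labelSymmetrizer, hrows, hcols, hookSymmetrizer,
    symmetrizer, antisymmetrizer]

theorem chi_hookPartition {d : ℕ} (k : Fin d) (q : d.Partition) :
    chi (hookPartition k) q = (-1) ^ (k : ℕ) * (hookPoly ℚ q.parts).coeff k := by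
  set Y := diagram (hookPartition k) with hY
  have hhook : ((1, 1) : ℕ × ℕ) ∉ Y := by
    rw [hY, YoungDiagram.mem_iff_lt_rowLen, rowLen_hookPartition_succ]
    split_ifs <;> simp
  have hcorner : ((0, 0) : ℕ × ℕ) ∈ Y.cells := by
    rw [YoungDiagram.mem_cells, YoungDiagram.mem_iff_lt_rowLen, rowLen_hookPartition_zero]
    exact Nat.sub_pos_of_lt k.2
  have hcard : (cellsBelow Y).card = k := by
    have hadd := Finset.card_compl_add_card (cellsBelow Y)
    rw [card_cells_diagram, card_compl_cellsBelow, rowLen_hookPartition_zero] at hadd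
    omega
  have hx : (⟨(0, 0), hcorner⟩ : Y.cells) ∉ cellsBelow Y := by simp [mem_cellsBelow]
  rw [chi, character_spechtRep (youngSymmetrizer_eq_hookSymmetrizer hhook (x := ⟨_, hcorner⟩) rfl),
    character_hookSymmetrizer_compl ℚ _ hx, (exists_perm_parts (hookPartition k) q).choose_spec,
    hcard]

theorem chi_hookPartition_indiscrete {d : ℕ} (k : Fin d) :
    chi (hookPartition k) (Nat.Partition.indiscrete d) = (-1) ^ (k : ℕ) := by
  rw [chi_hookPartition, Nat.Partition.indiscrete_parts k.pos.ne', coeff_hookPoly_singleton ℚ k.2,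
    mul_one]

end HookDiagram

section HurwitzSum

theorem shiftedPowerSum_hookPartition {d : ℕ} (k : Fin d) (e : ℕ) :
    shiftedPowerSum e (hookPartition k) =
      ((d : ℚ) - k - 1 / 2) ^ e - (-((k : ℕ) + 1 / 2 : ℚ)) ^ e := by
  have hleg : ∑ i ∈ Finset.range k, ((((diagram (hookPartition k)).rowLen (i + 1) : ℚ) -
        (((i + 1 : ℕ) : ℚ) + 1) + 1 / 2) ^ e - (-(((i + 1 : ℕ) : ℚ) + 1) + 1 / 2) ^ e)
      = (-1 / 2) ^ e - (-((k : ℕ) + 1 / 2 : ℚ)) ^ e := by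
    have htelescope := Finset.sum_range_sub' (fun i : ℕ => (-((i : ℚ) + 1 / 2)) ^ e) k
    convert htelescope using 1
    · refine Finset.sum_congr rfl fun i hi => ?_
      rw [rowLen_hookPartition_succ, if_pos (Finset.mem_range.1 hi)]
      push_cast
      ring
    · norm_num
  rw [shiftedPowerSum, finsum_eq_sum_of_support_subset (s := Finset.range (k + 1)),
    Finset.sum_range_succ', hleg, rowLen_hookPartition_zero, Nat.cast_sub k.2.le]
  · push_cast
    ring
  · intro i hi
    contrapose! hi
    obtain ⟨j, rfl⟩ := Nat.exists_eq_succ_of_ne_zero (n := i) (by rintro rfl; simp at hi)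
    have hj : ¬ j < k := by simpa using hi
    simp [rowLen_hookPartition_succ, hj]

theorem shiftedPowerSum_three_hookPartition {d : ℕ} (k : Fin d) :
    shiftedPowerSum 3 (hookPartition k) / ((3).factorial : ℚ)
      = (d : ℚ) / 2 * (((k : ℚ) + 1 / 2 - d / 2) ^ 2 + (d : ℚ) ^ 2 / 12) := by
  rw [shiftedPowerSum_hookPartition]
  norm_num [Nat.factorial]
  ring

theorem doubleHurwitz_indiscrete_eq_sum {d : ℕ} (hd : d ≠ 0) (g s : ℕ) (β : d.Partition)
    (hs : 2 * s + 2 = 2 * g + Multiset.card (Nat.Partition.indiscrete d).parts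
      + Multiset.card β.parts) :
    doubleHurwitz g 2 s (Nat.Partition.indiscrete d) β hs
      = 1 / ((d : ℚ) * (β.parts.prod : ℚ)) * ∑ k ∈ Finset.range d, (hookPoly ℚ β.parts).coeff k *
        ((d : ℚ) / 2 * (((k : ℚ) + 1 / 2 - d / 2) ^ 2 + (d : ℚ) ^ 2 / 12)) ^ s := by
  rw [doubleHurwitz, Nat.Partition.indiscrete_parts hd, Multiset.prod_singleton, Finset.sum_range]
  congr 1
  refine (Fintype.sum_of_injective hookPartition hookPartition_injective _ _ ?_ ?_).symm
  · intro p hp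
    rw [chi_indiscrete_eq_zero (by_contra fun h => hp (mem_range_hookPartition hd h)), zero_mul,
      zero_mul]
  · intro k
    have hsign : ((-1 : ℚ) ^ (k : ℕ)) * (-1) ^ (k : ℕ) = 1 := by
      rw [← mul_pow, neg_one_mul, neg_neg, one_pow]
    rw [chi_hookPartition_indiscrete, chi_hookPartition, shiftedPowerSum_three_hookPartition]
    linear_combination (-(hookPoly ℚ β.parts).coeff k *
        ((d : ℚ) / 2 * (((k : ℚ) + 1 / 2 - d / 2) ^ 2 + (d : ℚ) ^ 2 / 12)) ^ s) * hsign

end HurwitzSum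

end Hurwitz

end

noncomputable section

namespace Hurwitz

/-! ### The power series `sinh (t / 2) / (t / 2)` -/

section SinhSeries

open PowerSeries

/-- The power series `exp (a t)`. -/
def expSeries (a : ℚ) : ℚ⟦X⟧ := rescale a (exp ℚ)

theorem coeff_expSeries (a : ℚ) (m : ℕ) : coeff m (expSeries a) = a ^ m / (m.factorial : ℚ) := by
  rw [expSeries, coeff_rescale, coeff_exp]
  simp [div_eq_mul_inv]

theorem expSeries_add (a b : ℚ) : expSeries (a + b) = expSeries a * expSeries b :=
  (exp_mul_exp_eq_exp_add a b).symm

theorem expSeries_zero : expSeries 0 = 1 := by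
  rw [expSeries, rescale_zero_apply, constantCoeff_exp, map_one]

theorem expSeries_natCast (k : ℕ) : expSeries k = exp ℚ ^ k :=
  (exp_pow_eq_rescale_exp k).symm

theorem coeff_expSeries_mul_aeval_exp {R : Polynomial ℚ} {N : ℕ} (hN : R.natDegree < N) (a : ℚ)
    (m : ℕ) :
    (m.factorial : ℚ) * coeff m (expSeries a * Polynomial.aeval (exp ℚ) R)
      = ∑ k ∈ Finset.range N, R.coeff k * (k + a) ^ m := by
  have hm : (m.factorial : ℚ) ≠ 0 := Nat.cast_ne_zero.2 (Nat.factorial_ne_zero m)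
  rw [Polynomial.aeval_eq_sum_range' hN, Finset.mul_sum, map_sum, Finset.mul_sum]
  refine Finset.sum_congr rfl fun k _ => ?_
  rw [mul_smul_comm, ← expSeries_natCast, ← expSeries_add, coeff_smul, coeff_expSeries, smul_eq_mul,
    add_comm]
  field_simp

/-- The power series `sinh (t / 2) / (t / 2)`. -/
def sinhSeries : ℚ⟦X⟧ := mk fun i => coeff (i + 1) (expSeries (1 / 2) - expSeries (-(1 / 2)))

theorem coeff_sinhSeries (i : ℕ) :
    coeff i sinhSeries = ((1 / 2) ^ (i + 1) - (-(1 / 2)) ^ (i + 1)) / ((i + 1).factorial : ℚ) := by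
  rw [sinhSeries, coeff_mk, map_sub, coeff_expSeries, coeff_expSeries, sub_div]

theorem coeff_sinhSeries_nonneg (i : ℕ) : 0 ≤ coeff i sinhSeries := by
  rw [coeff_sinhSeries]
  refine div_nonneg ?_ (Nat.cast_nonneg _)
  rcases Nat.even_or_odd (i + 1) with h | h
  · rw [h.neg_pow, sub_self]
  · rw [h.neg_pow, sub_neg_eq_add]
    positivity

theorem constantCoeff_sinhSeries : constantCoeff sinhSeries = 1 := by
  rw [← coeff_zero_eq_constantCoeff_apply, coeff_sinhSeries]
  norm_num

theorem constantCoeff_sinhSeries_ne_zero : constantCoeff sinhSeries ≠ 0 :=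
  constantCoeff_sinhSeries ▸ one_ne_zero

theorem X_mul_sinhSeries : X * sinhSeries = expSeries (1 / 2) - expSeries (-(1 / 2)) := by
  ext m
  cases m with
  | zero =>
    rw [coeff_zero_X_mul, map_sub, coeff_expSeries, coeff_expSeries, pow_zero, pow_zero, sub_self]
  | succ m => rw [coeff_succ_X_mul, sinhSeries, coeff_mk]

theorem X_mul_rescale_sinhSeries (b : ℚ) :
    C b * X * rescale b sinhSeries = expSeries (b / 2) - expSeries (-(b / 2)) := by
  have h := congrArg (rescale b) X_mul_sinhSeries
  rw [map_mul, rescale_X, map_sub, expSeries, expSeries, rescale_rescale, rescale_rescale] at h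
  rw [h, expSeries, expSeries, one_div_mul_eq_div, neg_mul, one_div_mul_eq_div]

theorem X_mul_rescale_natCast_sinhSeries (b : ℕ) :
    C (b : ℚ) * X * rescale (b : ℚ) sinhSeries
      = (-1) * expSeries (-(b / 2)) * (1 - exp ℚ ^ b) := by
  have hhalf : expSeries (b / 2) = expSeries (-(b / 2)) * exp ℚ ^ b := by
    rw [← expSeries_natCast, ← expSeries_add]
    ring_nf
  rw [X_mul_rescale_sinhSeries, hhalf]
  ring

theorem sinhSeries_inv_eq :
    sinhSeries⁻¹ = C 2 * rescale (1 / 2) (bernoulliPowerSeries ℚ) - bernoulliPowerSeries ℚ := by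
  set B := bernoulliPowerSeries ℚ
  set e := expSeries (1 / 2)
  set e' := expSeries (-(1 / 2))
  have hsq : exp ℚ = e * e := by
    rw [← expSeries_add, add_halves, expSeries, rescale_one, RingHom.id_apply]
  have hinv : e * e' = 1 := by rw [← expSeries_add, add_neg_cancel, expSeries_zero]
  have hbernoulli : B * (exp ℚ - 1) = X := bernoulliPowerSeries_mul_exp_sub_one ℚ
  have hrescale : rescale (1 / 2) B * (e - 1) = C (1 / 2) * X := by
    rw [← rescale_X, ← hbernoulli, map_mul, map_sub, map_one]
    rfl
  have htwo : (C 2 : ℚ⟦X⟧) * C (1 / 2) = 1 := by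
    rw [← map_mul]
    norm_num
  have hfirst : C 2 * rescale (1 / 2) B * (e - e') = X * (1 + e') := by
    linear_combination (C 2 * (1 + e')) * hrescale + X * (1 + e') * htwo
      - C 2 * rescale (1 / 2) B * hinv
  have hsecond : B * (e - e') = X * e' := by
    rw [hsq] at hbernoulli
    linear_combination e' * hbernoulli - B * e * hinv
  rw [eq_comm, PowerSeries.eq_inv_iff_mul_eq_one constantCoeff_sinhSeries_ne_zero]
  refine mul_left_cancel₀ X_ne_zero ?_
  calc X * ((C 2 * rescale (1 / 2) B - B) * sinhSeries)
      = (C 2 * rescale (1 / 2) B - B) * (X * sinhSeries) := mul_left_comm _ _ _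
    _ = X * 1 := by rw [X_mul_sinhSeries, sub_mul, hfirst, hsecond]; ring

theorem bernoulli_two_mul_ne_zero (g : ℕ) : bernoulli (2 * g) ≠ 0 := by
  rcases eq_or_ne g 0 with rfl | hg
  · simp
  intro h
  have hzeta : riemannZeta (2 * g) ≠ 0 := by
    refine riemannZeta_ne_zero_of_one_le_re ?_
    have hg' : (1 : ℝ) ≤ g := by exact_mod_cast Nat.one_le_iff_ne_zero.2 hg
    simp only [Complex.mul_re, Complex.re_ofNat, Complex.natCast_re, Complex.im_ofNat,
      Complex.natCast_im, mul_zero, sub_zero]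
    linarith
  rw [riemannZeta_two_mul_nat hg, h] at hzeta
  simp at hzeta

theorem coeff_sinhSeries_inv_ne_zero (g : ℕ) : coeff (2 * g) sinhSeries⁻¹ ≠ 0 := by
  rw [sinhSeries_inv_eq, map_sub, coeff_C_mul, coeff_rescale, bernoulliPowerSeries, coeff_mk,
    ← mul_assoc, ← sub_one_mul]
  refine mul_ne_zero ?_ ?_
  · rcases Nat.eq_zero_or_pos g with rfl | hg
    · norm_num
    · have hle : (1 / 2 : ℚ) ^ (2 * g) ≤ (1 / 2) ^ 2 :=
        pow_le_pow_of_le_one (by norm_num) (by norm_num) (by omega)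
      have hlt : 2 * (1 / 2 : ℚ) ^ (2 * g) < 1 := by linarith
      exact (sub_neg.2 hlt).ne
  · simpa using ⟨bernoulli_two_mul_ne_zero g, Nat.factorial_ne_zero _⟩

end SinhSeries

/-! ### Moments of the hook characters -/

section Moments

open PowerSeries

theorem prod_X_mul_rescale_sinhSeries (s : Multiset ℕ) :
    (s.map fun b : ℕ => C (b : ℚ) * X * rescale (b : ℚ) sinhSeries).prod
      = (-1) ^ Multiset.card s * expSeries (-(s.sum / 2)) *
        (s.map fun b => 1 - exp ℚ ^ b).prod := by
  induction s using Multiset.induction_on with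
  | empty => simp [expSeries_zero]
  | cons b s ih =>
    have hsum : -((b ::ₘ s).sum / 2 : ℚ) = -(b / 2) + -(s.sum / 2) := by
      rw [Multiset.sum_cons]
      push_cast
      ring
    rw [Multiset.map_cons, Multiset.prod_cons, ih, X_mul_rescale_natCast_sinhSeries, hsum,
      expSeries_add, Multiset.card_cons, Multiset.map_cons, Multiset.prod_cons]
    ring

theorem one_sub_exp_mul_aeval_exp_hookPoly {s : Multiset ℕ} (hs : s ≠ 0) :
    (1 - exp ℚ) * Polynomial.aeval (exp ℚ) (hookPoly ℚ s)
      = (s.map fun b => 1 - exp ℚ ^ b).prod := by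
  have h := congrArg (Polynomial.aeval (exp ℚ)) (one_sub_X_mul_hookPoly ℚ hs)
  rw [map_multiset_prod, Multiset.map_map] at h
  simpa using h

theorem expSeries_mul_aeval_exp_hookPoly {s : Multiset ℕ} {n : ℕ} (hs : Multiset.card s = n + 1) :
    expSeries (1 / 2 - s.sum / 2) * Polynomial.aeval (exp ℚ) (hookPoly ℚ s)
      = C ((-1) ^ n * (s.prod : ℚ)) *
        (X ^ n * ((s.map fun b : ℕ => rescale (b : ℚ) sinhSeries).prod * sinhSeries⁻¹)) := by
  set R := Polynomial.aeval (exp ℚ) (hookPoly ℚ s)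
  set S := (s.map fun b : ℕ => rescale (b : ℚ) sinhSeries).prod
  have hs0 : s ≠ 0 := Multiset.card_pos.1 (hs ▸ n.succ_pos)
  have hprod : (s.map fun b : ℕ => (C (b : ℚ) : ℚ⟦X⟧)).prod = C (s.prod : ℚ) := by
    rw [Nat.cast_multiset_prod, map_multiset_prod, Multiset.map_map]
    rfl
  have hfactor : C (s.prod : ℚ) * X ^ (n + 1) * S
      = (-1) ^ (n + 1) * expSeries (-(s.sum / 2)) * ((1 - exp ℚ) * R) := by
    rw [one_sub_exp_mul_aeval_exp_hookPoly hs0, ← hs, ← prod_X_mul_rescale_sinhSeries,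
      Multiset.prod_map_mul, Multiset.prod_map_mul, Multiset.map_const', Multiset.prod_replicate,
      hprod]
  have hone : X * sinhSeries = (-1) * expSeries (-(1 / 2)) * (1 - exp ℚ) := by
    simpa using X_mul_rescale_natCast_sinhSeries 1
  have hexp : expSeries (1 / 2 - s.sum / 2) * expSeries (-(1 / 2)) = expSeries (-(s.sum / 2)) := by
    rw [← expSeries_add]
    ring_nf
  have hsign : (C ((-1) ^ n * (s.prod : ℚ)) : ℚ⟦X⟧) = (-1) ^ n * C (s.prod : ℚ) := by simp
  have hmul : X * sinhSeries * (expSeries (1 / 2 - s.sum / 2) * R)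
      = (-1) ^ n * (C (s.prod : ℚ) * X ^ (n + 1) * S) := by
    have hunit : ((-1) ^ n * (-1) ^ n : ℚ⟦X⟧) = 1 := by
      rw [← mul_pow, neg_one_mul, neg_neg, one_pow]
    rw [hfactor, hone, ← hexp, pow_succ]
    linear_combination (expSeries (1 / 2 - s.sum / 2) * expSeries (-(1 / 2)) * (1 - exp ℚ) * R) *
      hunit
  have hinv := PowerSeries.mul_inv_cancel sinhSeries constantCoeff_sinhSeries_ne_zero
  refine mul_left_cancel₀ X_ne_zero ?_
  rw [hsign]
  linear_combination sinhSeries⁻¹ * hmul - X * (expSeries (1 / 2 - s.sum / 2) * R) * hinv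

theorem sum_coeff_hookPoly_mul_pow {s : Multiset ℕ} {n : ℕ} (hs : Multiset.card s = n + 1)
    (hpos : ∀ b ∈ s, 0 < b) (m : ℕ) :
    ∑ k ∈ Finset.range s.sum, (hookPoly ℚ s).coeff k * ((k : ℚ) + 1 / 2 - s.sum / 2) ^ m
      = (m.factorial : ℚ) * ((-1) ^ n * s.prod * coeff m
        (X ^ n * ((s.map fun b : ℕ => rescale (b : ℚ) sinhSeries).prod * sinhSeries⁻¹))) := by
  have hdeg := natDegree_hookPoly_lt ℚ (Multiset.card_pos.1 (hs ▸ n.succ_pos)) hpos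
  simp only [add_sub_assoc]
  rw [← coeff_expSeries_mul_aeval_exp hdeg, expSeries_mul_aeval_exp_hookPoly hs, coeff_C_mul]

end Moments

/-! ### The coefficients of a product of rescaled power series -/

section RescaledProduct

open MvPolynomial Finset.HasAntidiagonal

variable {ι R : Type*} [Fintype ι] [CommSemiring R]

/-- The coefficient of `t ^ i` in the product of the power series `f (x t)` over the variables `x`,
as a polynomial in these variables. -/
def rescaledProdCoeff (ι : Type*) [Fintype ι] (f : PowerSeries R) (i : ℕ) : MvPolynomial ι R :=
  PowerSeries.coeff i (∏ j : ι, PowerSeries.rescale (X j) (PowerSeries.map C f))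

theorem isHomogeneous_rescaledProdCoeff (f : PowerSeries R) (i : ℕ) :
    (rescaledProdCoeff ι f i).IsHomogeneous i := by
  classical
  rw [rescaledProdCoeff]
  induction (Finset.univ : Finset ι) using Finset.induction_on generalizing i with
  | empty =>
    rw [Finset.prod_empty, PowerSeries.coeff_one]
    split_ifs with h
    · exact h ▸ isHomogeneous_one _ _
    · exact isHomogeneous_zero _ _ _
  | insert a s ha ih =>
    rw [Finset.prod_insert ha, PowerSeries.coeff_mul]
    refine IsHomogeneous.sum _ _ _ fun p hp => ?_
    rw [← mem_antidiagonal.1 hp, PowerSeries.coeff_rescale, PowerSeries.coeff_map]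
    exact ((isHomogeneous_X_pow a p.1).mul (isHomogeneous_C ι _)).mul (ih p.2)

theorem eval_rescaledProdCoeff (f : PowerSeries R) (i : ℕ) (x : ι → R) :
    eval x (rescaledProdCoeff ι f i)
      = PowerSeries.coeff i (∏ j, PowerSeries.rescale (x j) f) := by
  rw [rescaledProdCoeff, ← PowerSeries.coeff_map, map_prod]
  congr 1
  refine Finset.prod_congr rfl fun j _ => ?_
  ext m
  simp only [PowerSeries.coeff_map, PowerSeries.coeff_rescale, map_mul, map_pow, eval_X, eval_C]

theorem eval_rescaledProdCoeff_zero (f : PowerSeries R) (x : ι → R) :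
    eval x (rescaledProdCoeff ι f 0) = PowerSeries.constantCoeff f ^ Fintype.card ι := by
  rw [eval_rescaledProdCoeff, PowerSeries.coeff_zero_eq_constantCoeff_apply, map_prod,
    ← Finset.card_univ]
  refine Finset.prod_eq_pow_card fun j _ => ?_
  rw [← PowerSeries.coeff_zero_eq_constantCoeff_apply, PowerSeries.coeff_rescale, pow_zero, one_mul,
    PowerSeries.coeff_zero_eq_constantCoeff_apply]

theorem eval_rescaledProdCoeff_nonneg [PartialOrder R] [IsOrderedRing R] {f : PowerSeries R}
    (hf : ∀ m, 0 ≤ PowerSeries.coeff m f) {x : ι → R} (hx : ∀ j, 0 ≤ x j) (i : ℕ) :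
    0 ≤ eval x (rescaledProdCoeff ι f i) := by
  classical
  rw [eval_rescaledProdCoeff]
  induction (Finset.univ : Finset ι) using Finset.induction_on generalizing i with
  | empty =>
    rw [Finset.prod_empty, PowerSeries.coeff_one]
    split_ifs
    · exact zero_le_one
    · exact le_rfl
  | insert a s ha ih =>
    rw [Finset.prod_insert ha, PowerSeries.coeff_mul]
    refine Finset.sum_nonneg fun p _ => mul_nonneg ?_ (ih p.2)
    rw [PowerSeries.coeff_rescale]
    exact mul_nonneg (pow_nonneg (hx a) _) (hf _)

end RescaledProduct

/-! ### The Hurwitz polynomials -/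

section HurwitzPoly

open MvPolynomial Finset.HasAntidiagonal

variable {g h j : ℕ}

/-- The coefficient with which the moment of order `2 (h + j)` of the hook characters enters the
Hurwitz number. -/
def momentWeight (g h j : ℕ) : ℚ :=
  ((g + h).choose (h + j) : ℚ) * ((2 * (h + j)).factorial : ℚ) / 12 ^ (g - j)

theorem momentWeight_pos (hj : j ≤ g) : 0 < momentWeight g h j := by
  have hchoose : 0 < (g + h).choose (h + j) := Nat.choose_pos (by omega)
  rw [momentWeight]
  positivity

/-- The contribution to the Hurwitz polynomial of the moment of order `2 (h + j)` and of the
coefficients of index `p.1` in `∏ sinhSeries (x t)` and of index `p.2` in `1 / sinhSeries t`. -/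
def hurwitzTerm (g h j : ℕ) (p : ℕ × ℕ) : MvPolynomial (Fin (2 * h + 1)) ℚ :=
  C (1 / 2 ^ (g + h) * (momentWeight g h j * PowerSeries.coeff p.2 sinhSeries⁻¹)) *
    ((∑ i, X i) ^ (g + h - 1 + 2 * (g - j)) * rescaledProdCoeff _ sinhSeries p.1)

/-- The polynomial expressing the one-part double Hurwitz numbers of genus `g` with completed
`3`-cycles in the `2 h + 1` parts of the second partition. -/
def hurwitzPoly (g h : ℕ) : MvPolynomial (Fin (2 * h + 1)) ℚ :=
  ∑ j ∈ Finset.range (g + 1), ∑ p ∈ antidiagonal (2 * j), hurwitzTerm g h j p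

theorem isHomogeneous_hurwitzTerm (g h j : ℕ) (p : ℕ × ℕ) :
    (hurwitzTerm g h j p).IsHomogeneous (g + h - 1 + 2 * (g - j) + p.1) := by
  have hsum : (∑ i, X i : MvPolynomial (Fin (2 * h + 1)) ℚ).IsHomogeneous 1 :=
    IsHomogeneous.sum _ _ _ fun i _ => isHomogeneous_X ℚ i
  simpa only [hurwitzTerm, one_mul] using
    ((hsum.pow (g + h - 1 + 2 * (g - j))).mul (isHomogeneous_rescaledProdCoeff _ p.1)).C_mul _

theorem eval_hurwitzTerm (g h j : ℕ) (p : ℕ × ℕ) (x : Fin (2 * h + 1) → ℚ) :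
    eval x (hurwitzTerm g h j p) =
      1 / 2 ^ (g + h) * (momentWeight g h j * PowerSeries.coeff p.2 sinhSeries⁻¹) *
        ((∑ i, x i) ^ (g + h - 1 + 2 * (g - j)) * eval x (rescaledProdCoeff _ sinhSeries p.1)) := by
  simp only [hurwitzTerm, map_mul, map_pow, map_sum, eval_C, eval_X]

theorem eval_hurwitzPoly (g h : ℕ) (x : Fin (2 * h + 1) → ℚ) :
    eval x (hurwitzPoly g h) = 1 / 2 ^ (g + h) * ∑ j ∈ Finset.range (g + 1), momentWeight g h j *
      (∑ i, x i) ^ (g + h - 1 + 2 * (g - j)) *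
        PowerSeries.coeff (2 * j)
          ((∏ i, PowerSeries.rescale (x i) sinhSeries) * sinhSeries⁻¹) := by
  rw [hurwitzPoly, map_sum, Finset.mul_sum]
  refine Finset.sum_congr rfl fun j _ => ?_
  rw [map_sum, PowerSeries.coeff_mul, Finset.mul_sum, Finset.mul_sum]
  refine Finset.sum_congr rfl fun p _ => ?_
  rw [eval_hurwitzTerm, eval_rescaledProdCoeff]
  ring

theorem homogeneousComponent_hurwitzPoly (g h N : ℕ) :
    homogeneousComponent N (hurwitzPoly g h) =
      ∑ j ∈ Finset.range (g + 1), ∑ p ∈ antidiagonal (2 * j),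
        if N = g + h - 1 + 2 * (g - j) + p.1 then hurwitzTerm g h j p else 0 := by
  simp only [hurwitzPoly, map_sum]
  refine Finset.sum_congr rfl fun j _ => Finset.sum_congr rfl fun p _ => ?_
  exact homogeneousComponent_of_mem ((mem_homogeneousSubmodule _ _).2
    (isHomogeneous_hurwitzTerm g h j p))

theorem homogeneousDegrees_hurwitzPoly_subset (g h : ℕ) :
    homogeneousDegrees (hurwitzPoly g h) ⊆ Set.Icc (g + h - 1) (g + h - 1 + 2 * g) := by
  intro N hN
  by_contra hmem
  refine hN ?_
  rw [homogeneousComponent_hurwitzPoly]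
  refine Finset.sum_eq_zero fun j hj => Finset.sum_eq_zero fun p hp => if_neg ?_
  have hp' := mem_antidiagonal.1 hp
  have hj' := Finset.mem_range.1 hj
  rw [Set.mem_Icc] at hmem
  omega

theorem homogeneousComponent_bot_hurwitzPoly (g h : ℕ) :
    homogeneousComponent (g + h - 1) (hurwitzPoly g h) = hurwitzTerm g h g (0, 2 * g) := by
  rw [homogeneousComponent_hurwitzPoly, Finset.sum_eq_single_of_mem g (by simp),
    Finset.sum_eq_single_of_mem (0, 2 * g) (by simp), if_pos (by simp)]
  · rintro ⟨i, l⟩ hp hne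
    have hp' := mem_antidiagonal.1 hp
    simp only [ne_eq, Prod.mk.injEq] at hne hp' ⊢
    exact if_neg (by omega)
  · intro j hj hne
    have hj' := Finset.mem_range.1 hj
    exact Finset.sum_eq_zero fun p _ => if_neg (by omega)

theorem homogeneousComponent_top_hurwitzPoly (g h : ℕ) :
    homogeneousComponent (g + h - 1 + 2 * g) (hurwitzPoly g h)
      = ∑ j ∈ Finset.range (g + 1), hurwitzTerm g h j (2 * j, 0) := by
  rw [homogeneousComponent_hurwitzPoly]
  refine Finset.sum_congr rfl fun j hj => ?_
  have hj' := Finset.mem_range.1 hj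
  rw [Finset.sum_eq_single_of_mem (2 * j, 0) (by simp), if_pos (by simp only; omega)]
  rintro ⟨i, l⟩ hp hne
  have hp' := mem_antidiagonal.1 hp
  simp only [ne_eq, Prod.mk.injEq] at hne hp' ⊢
  exact if_neg (by omega)

theorem eval_hurwitzTerm_bot_ne_zero (g : ℕ) {x : Fin (2 * h + 1) → ℚ} (hx : ∑ i, x i ≠ 0) :
    eval x (hurwitzTerm g h g (0, 2 * g)) ≠ 0 := by
  rw [eval_hurwitzTerm, eval_rescaledProdCoeff_zero, constantCoeff_sinhSeries, one_pow, mul_one]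
  exact mul_ne_zero (mul_ne_zero (by positivity)
    (mul_ne_zero (momentWeight_pos le_rfl).ne' (coeff_sinhSeries_inv_ne_zero g))) (pow_ne_zero _ hx)

theorem eval_hurwitzTerm_top (g h j : ℕ) (x : Fin (2 * h + 1) → ℚ) :
    eval x (hurwitzTerm g h j (2 * j, 0)) = 1 / 2 ^ (g + h) * momentWeight g h j *
      (∑ i, x i) ^ (g + h - 1 + 2 * (g - j)) *
        eval x (rescaledProdCoeff _ sinhSeries (2 * j)) := by
  rw [eval_hurwitzTerm, PowerSeries.coeff_zero_eq_constantCoeff_apply,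
    PowerSeries.constantCoeff_inv, constantCoeff_sinhSeries, inv_one, mul_one, ← mul_assoc]

theorem sum_eval_hurwitzTerm_top_pos (g : ℕ) {x : Fin (2 * h + 1) → ℚ} (hx : ∀ i, 0 < x i) :
    0 < ∑ j ∈ Finset.range (g + 1), eval x (hurwitzTerm g h j (2 * j, 0)) := by
  have hsum : 0 < ∑ i, x i := Finset.sum_pos (fun i _ => hx i) ⟨0, Finset.mem_univ _⟩
  have hpos : ∀ j ∈ Finset.range (g + 1), 0 < 1 / 2 ^ (g + h) * momentWeight g h j *
      (∑ i, x i) ^ (g + h - 1 + 2 * (g - j)) := fun j hj => by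
    have hweight : 0 < momentWeight g h j :=
      momentWeight_pos (Nat.lt_succ_iff.1 (Finset.mem_range.1 hj))
    positivity
  simp only [eval_hurwitzTerm_top]
  refine Finset.sum_pos' (fun j hj => mul_nonneg (hpos j hj).le
    (eval_rescaledProdCoeff_nonneg coeff_sinhSeries_nonneg (fun i => (hx i).le) _))
    ⟨0, by simp, mul_pos (hpos 0 (by simp)) ?_⟩
  rw [mul_zero, eval_rescaledProdCoeff_zero, constantCoeff_sinhSeries, one_pow]
  exact one_pos

theorem isLeast_homogeneousDegrees_hurwitzPoly (g h : ℕ) :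
    IsLeast (homogeneousDegrees (hurwitzPoly g h)) (g + h - 1) := by
  refine ⟨?_, fun N hN => (homogeneousDegrees_hurwitzPoly_subset g h hN).1⟩
  rw [homogeneousDegrees, Set.mem_ofPred_eq, homogeneousComponent_bot_hurwitzPoly]
  refine ne_zero_of_map (f := eval fun _ => 1) (eval_hurwitzTerm_bot_ne_zero g ?_)
  rw [Finset.sum_const, Finset.card_univ, Fintype.card_fin, nsmul_one]
  positivity

theorem isGreatest_homogeneousDegrees_hurwitzPoly (g h : ℕ) :
    IsGreatest (homogeneousDegrees (hurwitzPoly g h)) (g + h - 1 + 2 * g) := by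
  refine ⟨?_, fun N hN => (homogeneousDegrees_hurwitzPoly_subset g h hN).2⟩
  rw [homogeneousDegrees, Set.mem_ofPred_eq, homogeneousComponent_top_hurwitzPoly]
  refine ne_zero_of_map (f := eval fun _ => 1) ?_
  rw [map_sum]
  exact (sum_eval_hurwitzTerm_top_pos g fun _ => one_pos).ne'

end HurwitzPoly

/-! ### Polynomiality -/

section Polynomiality

open PowerSeries

theorem sum_mul_sq_add_pow {ι R : Type*} [CommSemiring R] (t : Finset ι) (w x : ι → R) (c : R)
    (N : ℕ) :
    ∑ k ∈ t, w k * (x k ^ 2 + c) ^ N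
      = ∑ m ∈ Finset.range (N + 1), N.choose m * c ^ (N - m) * ∑ k ∈ t, w k * x k ^ (2 * m) := by
  simp only [add_pow, Finset.mul_sum]
  rw [Finset.sum_comm]
  refine Finset.sum_congr rfl fun m _ => Finset.sum_congr rfl fun k _ => ?_
  rw [pow_mul]
  ring

theorem sum_coeff_hookPoly_mul_sq_add_pow {s : Multiset ℕ} {h : ℕ}
    (hs : Multiset.card s = 2 * h + 1) (hpos : ∀ b ∈ s, 0 < b) (g : ℕ) (c : ℚ) :
    ∑ k ∈ Finset.range s.sum,
      (hookPoly ℚ s).coeff k * (((k : ℚ) + 1 / 2 - s.sum / 2) ^ 2 + c) ^ (g + h)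
      = s.prod * ∑ j ∈ Finset.range (g + 1),
        (g + h).choose (h + j) * (2 * (h + j)).factorial * c ^ (g - j) *
          coeff (2 * j) ((s.map fun b : ℕ => rescale (b : ℚ) sinhSeries).prod * sinhSeries⁻¹) := by
  rw [sum_mul_sq_add_pow, show g + h + 1 = h + (g + 1) by ring, Finset.sum_range_add,
    Finset.sum_eq_zero, zero_add, Finset.mul_sum]
  · refine Finset.sum_congr rfl fun j _ => ?_
    rw [sum_coeff_hookPoly_mul_pow hs hpos, (even_two_mul h).neg_one_pow, one_mul,
      show 2 * (h + j) = 2 * j + 2 * h by ring, coeff_X_pow_mul,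
      show g + h - (h + j) = g - j by omega]
    ring
  · intro m hm
    have hm' := Finset.mem_range.1 hm
    rw [sum_coeff_hookPoly_mul_pow hs hpos, coeff_X_pow_mul', if_neg (by omega), mul_zero, mul_zero,
      mul_zero]

theorem doubleHurwitz_indiscrete_eq_eval {d : ℕ} (hd : d ≠ 0) {g h : ℕ} (hgh : g + h ≠ 0)
    (β : d.Partition) (b : Fin (2 * h + 1) → ℕ) (hβ : β.parts = Multiset.map b Finset.univ.val)
    (hs : 2 * (g + h) + 2 = 2 * g + Multiset.card (Nat.Partition.indiscrete d).parts
      + Multiset.card β.parts) :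
    doubleHurwitz g 2 (g + h) (Nat.Partition.indiscrete d) β hs
      = MvPolynomial.eval (fun i => (b i : ℚ)) (hurwitzPoly g h) := by
  have hcard : Multiset.card β.parts = 2 * h + 1 := by
    rw [hβ, Multiset.card_map, Finset.card_val, Finset.card_univ, Fintype.card_fin]
  have hsum : ∑ i, (b i : ℚ) = d := by
    rw [← Nat.cast_sum, ← β.parts_sum, hβ]
    rfl
  have hprod : (β.parts.map fun c : ℕ => rescale (c : ℚ) sinhSeries).prod
      = ∏ i, rescale (b i : ℚ) sinhSeries := by
    rw [hβ, Multiset.map_map]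
    rfl
  have hprod0 : (β.parts.prod : ℚ) ≠ 0 :=
    Nat.cast_ne_zero.2 (Multiset.prod_ne_zero fun h0 => (β.parts_pos h0).false)
  have hd0 : (d : ℚ) ≠ 0 := Nat.cast_ne_zero.2 hd
  have hmoment := sum_coeff_hookPoly_mul_sq_add_pow hcard (fun _ => β.parts_pos) g
    ((d : ℚ) ^ 2 / 12)
  rw [β.parts_sum, hprod] at hmoment
  simp only [doubleHurwitz_indiscrete_eq_sum hd, mul_pow (_ / _),
    mul_left_comm _ ((_ / _) ^ (g + h)), ← Finset.mul_sum]
  rw [hmoment, eval_hurwitzPoly, hsum]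
  simp only [Finset.mul_sum]
  refine Finset.sum_congr rfl fun j _ => ?_
  obtain ⟨N, hN⟩ := Nat.exists_eq_add_one_of_ne_zero hgh
  rw [hN, Nat.add_sub_cancel, momentWeight, hN, pow_add _ N (2 * _), pow_mul _ 2, div_pow, div_pow,
    pow_succ]
  field_simp

end Polynomiality

end Hurwitz

end

theorem corollary4p1 (g n : ℕ) (hn : Odd n) (hgn : ¬ (g = 0 ∧ n = 1)) :
    ∃ P : MvPolynomial (Fin n) ℚ,
      (∀ (d : ℕ) (β : d.Partition) (b : Fin n → ℕ),
        β.parts = Multiset.map b Finset.univ.val →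
        ∃ (s : ℕ) (hs : 2 * s + 2 = 2 * g
            + Multiset.card (Nat.Partition.indiscrete d).parts + Multiset.card β.parts),
          Hurwitz.doubleHurwitz g 2 s (Nat.Partition.indiscrete d) β hs
            = MvPolynomial.eval (fun i => (b i : ℚ)) P) ∧
      (∃ hi : ℕ, (hi : ℚ) = 3 * (g : ℚ) + ((n : ℚ) - 3) / 2 ∧
        IsGreatest (Hurwitz.homogeneousDegrees P) hi) ∧
      (∃ lo : ℕ, (lo : ℚ) = (g : ℚ) + ((n : ℚ) - 3) / 2 ∧
        IsLeast (Hurwitz.homogeneousDegrees P) lo) := by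
  obtain ⟨h, rfl⟩ := hn
  have hgh : g + h ≠ 0 := by omega
  have hdegree : ((g + h - 1 : ℕ) : ℚ) = g + ((2 * h + 1 : ℕ) - 3) / 2 := by
    rw [Nat.cast_pred (Nat.pos_of_ne_zero hgh)]
    push_cast
    ring
  refine ⟨Hurwitz.hurwitzPoly g h, fun d β b hβ => ?_,
    ⟨g + h - 1 + 2 * g, ?_, Hurwitz.isGreatest_homogeneousDegrees_hurwitzPoly g h⟩,
    ⟨g + h - 1, hdegree, Hurwitz.isLeast_homogeneousDegrees_hurwitzPoly g h⟩⟩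
  · have hcard : Multiset.card β.parts = 2 * h + 1 := by simp [hβ]
    have hd : d ≠ 0 := by
      rintro rfl
      simp at hcard
    refine ⟨g + h, ?_, Hurwitz.doubleHurwitz_indiscrete_eq_eval hd hgh β b hβ _⟩
    rw [Nat.Partition.indiscrete_parts hd, hcard, Multiset.card_singleton]
    ring
  · rw [Nat.cast_add, hdegree]
    push_cast
    ring
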